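/- Let $n\in\mathbb{N}$, let $\Omega\subset\mathbb{R}^n$ be open, let $d(x,y)=\|x-y\|$ be the metric induced by an arbitrary norm $\|\cdot\|$ on $\mathbb{R}^n$, and write $B(x,r)=\{y:\|y-x\|<r\}$. Let $w\in L^1_{loc}(\Omega)$ with $w>0$ a.e. in $\Omega$, put $d\mu=w\,dx$, and suppose that $w\in W^{2l,\infty}_{loc}(\Omega)$ for some integer $l\ge 1$. Let $u:\Omega\to\mathbb{R}$ be strongly harmonic, that is, $u$ is locally integrable in $\Omega$ with respect to $\mu$ and $$u(x)=\frac{1}{\mu(B(x,r))}\int_{B(x,r)}u\,d\mu$$ for all $x$ and $r>0$ such that $\overline{B(x,r)}$ is a compact subset of $\Omega$. Then $u$ is a weak solution in $\Omega$ of the system $$\sum_{|\alpha|=j}A_\alpha\bigl(D^\alpha(uw)-u\,D^\alpha w\bigr)=0,\qquad j=2,4,\ldots,2l,$$ where for each multi-index $\alpha\in\mathbb{N}^n$ $$A_\alpha=\binom{|\alpha|}{\alpha}\int_{B(0,1)}x^\alpha\,dx=\frac{|\alpha|!}{\alpha_1!\cdots\alpha_n!}\int_{B(0,1)}x_1^{\alpha_1}\cdots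 x_n^{\alpha_n}\,dx.$$ Here weak solution means: for every $j\in\{2,4,\ldots,2l\}$ and every $|\alpha|=j$ the weak derivatives $D^\alpha(uw)$ and $D^\alpha w$ exist in $L^1_{loc}(\Omega)$, the product $u\,D^\alpha w$ is in $L^1_{loc}(\Omega)$, and $$\int_\Omega\varphi\sum_{|\alpha|=j}A_\alpha\bigl(D^\alpha(uw)-u\,D^\alpha w\bigr)\,dx=0\qquad\text{for all }\varphi\in C_c^\infty(\Omega).$$ -/

import Mathlib

open MeasureTheory
open scoped ContDiff

/-- `ℝⁿ`. Its topology, smooth structure and Lebesgue measure (`volume`) do not depend on the choice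
of a norm; the norm that induces the metric of the problem is a separate object. -/
abbrev Rn (n : ℕ) : Type := EuclideanSpace ℝ (Fin n)

/-- `V ⋐ Ω`: the closure of `V` is compact and contained in `Ω`. -/
def CompactlyContained {n : ℕ} (V Ω : Set (Rn n)) : Prop :=
  IsCompact (closure V) ∧ closure V ⊆ Ω

/-- The first order partial derivative `∂f/∂xᵢ`. -/
noncomputable def partialD {n : ℕ} (i : Fin n) (f : Rn n → ℝ) : Rn n → ℝ :=
  fun x => fderiv ℝ f x (EuclideanSpace.single i 1)

/-- The classical derivative `D^α f = ∂₁^{α₁} ⋯ ∂ₙ^{αₙ} f` for a multi-index `α`. -/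
noncomputable def multiD {n : ℕ} (α : Fin n → ℕ) (f : Rn n → ℝ) : Rn n → ℝ :=
  (List.finRange n).foldr (fun i g => (partialD i)^[α i] g) f

/-- Test functions: `φ ∈ C_c^∞(Ω)`. -/
def IsTestFunction {n : ℕ} (Ω : Set (Rn n)) (φ : Rn n → ℝ) : Prop :=
  ContDiff ℝ ∞ φ ∧ HasCompactSupport φ ∧ tsupport φ ⊆ Ω

/-- `g` is the weak derivative `D^α f` in `Ω`; both functions are locally integrable in `Ω`.
Only the restrictions of `f` and `g` to `Ω`, up to null sets, matter, and `g` is unique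
almost everywhere in `Ω`. -/
def HasWeakD {n : ℕ} (Ω : Set (Rn n)) (α : Fin n → ℕ) (f g : Rn n → ℝ) : Prop :=
  LocallyIntegrableOn f Ω volume ∧ LocallyIntegrableOn g Ω volume ∧
    ∀ φ : Rn n → ℝ, IsTestFunction Ω φ →
      ∫ x in Ω, f x * multiD α φ x = (-1 : ℝ) ^ (∑ i, α i) * ∫ x in Ω, g x * φ x

/-- `f ∈ W^{k,∞}_loc(Ω)`: all weak derivatives of order at most `k` (including `f` itself) exist
and are essentially bounded on every compact subset of `Ω`. -/
def MemSobolevInftyLoc {n : ℕ} (Ω : Set (Rn n)) (k : ℕ) (f : Rn n → ℝ) : Prop :=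
  ∀ α : Fin n → ℕ, ∑ i, α i ≤ k → ∃ g : Rn n → ℝ, HasWeakD Ω α f g ∧
    ∀ K : Set (Rn n), IsCompact K → K ⊆ Ω → MemLp g ⊤ (volume.restrict K)

/-- The weighted Lebesgue measure `w dx` on `Ω`. -/
noncomputable def weightedMeasure {n : ℕ} (Ω : Set (Rn n)) (w : Rn n → ℝ) : Measure (Rn n) :=
  (volume.restrict Ω).withDensity (fun x => ENNReal.ofReal (w x))

/-- `u` is strongly harmonic in `Ω` for the metric `N (x - y)` and the measure `μ`: it is locally
integrable and has the mean value property on all balls compactly contained in `Ω`. -/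
def IsStronglyHarmonic {n : ℕ} (N : Seminorm ℝ (Rn n)) (μ : Measure (Rn n)) (Ω : Set (Rn n))
    (u : Rn n → ℝ) : Prop :=
  LocallyIntegrableOn u Ω μ ∧
    ∀ x : Rn n, ∀ r : ℝ, 0 < r → CompactlyContained (N.ball x r) Ω →
      u x = ⨍ y in N.ball x r, u y ∂μ

/-- `A_α = (|α|! / (α₁! ⋯ αₙ!)) ∫_{B(0,1)} x^α dx`, where `B(0,1)` is the unit ball of `N`. -/
noncomputable def coeffA {n : ℕ} (N : Seminorm ℝ (Rn n)) (α : Fin n → ℕ) : ℝ :=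
  (Nat.multinomial Finset.univ α : ℝ) * ∫ x in N.ball 0 1, ∏ i, x i ^ α i

/-- `u` is a weak solution in `Ω` of `∑_{|α| = j} A_α (D^α (u w) - u D^α w) = 0`: the weak derivatives
`P α = D^α (u w)` and `Q α = D^α w`, `|α| = j`, exist in `Ω`, the products `u D^α w` are locally
integrable, and the equation holds when integrated against every test function.
Because weak derivatives are unique almost everywhere, the choice of `P` and `Q` is irrelevant. -/
def IsWeakSolution {n : ℕ} (N : Seminorm ℝ (Rn n)) (Ω : Set (Rn n)) (w u : Rn n → ℝ)
    (j : ℕ) : Prop :=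
  ∃ P Q : (Fin n → ℕ) → Rn n → ℝ,
    (∀ α ∈ Finset.piAntidiag Finset.univ j,
      HasWeakD Ω α (fun x => u x * w x) (P α) ∧ HasWeakD Ω α w (Q α) ∧
        LocallyIntegrableOn (fun x => u x * Q α x) Ω volume) ∧
    ∀ φ : Rn n → ℝ, IsTestFunction Ω φ →
      ∫ x in Ω, φ x * ∑ α ∈ Finset.piAntidiag Finset.univ j,
        coeffA N α * (P α x - u x * Q α x) = 0

/-!
Write `f = u w`. The mean value property says that `u(x) ∫_B w(x + r y) dy = ∫_B f(x + r y) dy` for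
small `r`, where `B` is the unit ball of `N`. Differentiating `j` times in `r` at `r = 0` gives the
equation of order `j`, since `∫_B y^α dy`, weighted by the multinomial coefficient, is the constant
`A_α`. Two points need care: `f` must be shown to have weak derivatives, and `w` has only weak ones.

*Regularity.* Averaging the mean value property over the radii `0 < r < R` gives
`u · (w * K) = f * K` for the cone `K(y) = (R - N y)⁺`, see
`IsStronglyHarmonic.mul_integral_coneKernel`. The cone is Lipschitz, so Rademacher's theorem lets
one derivative fall on `K`; convolution with `K` thus gains a derivative, mapping functions with `k`
weak derivatives in `L¹_loc` to functions of class `C^{k+1}`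
(`MemSobolevOneLoc.contDiffOn_integral_mul_comp_sub`). As `w * K > 0`, the quotient `u` is of class
`C¹`, hence `f = u w` has one weak derivative, hence `u` is of class `C²`, and so on as long as `w`
has weak derivatives (`IsStronglyHarmonic.contDiffOn_and_memSobolevOneLoc`).

*The equations.* Tested with `φ`, the mean value property reads
`∫_B ∫ f(z) φ(z - r y) dz dy = ∫_B ∫ w(z) (u φ)(z - r y) dz dy`
(`IsStronglyHarmonic.dilationPairing_eq`). Both sides are differentiated in `r`; each derivative,
which falls on the test function, is moved to `f` or `w`. This uses `u φ ∈ C¹` only, because the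
weak derivative identity extends to Lipschitz test functions
(`HasWeakPartial.integral_mul_partialD`). The multinomial coefficients are collected in
`sum_multinomial_mul_eq_zero`, and `r = 0` is inserted at the end.
-/

/-! ### Multi-index derivatives and weak derivatives -/

theorem ContDiff.partialD {n : ℕ} {φ : Rn n → ℝ} (hφ : ContDiff ℝ ∞ φ) (i : Fin n) :
    ContDiff ℝ ∞ (partialD i φ) :=
  (hφ.fderiv_right (m := ∞) (by simp)).clm_apply contDiff_const

theorem ContDiff.iterate_partialD {n : ℕ} {φ : Rn n → ℝ} (hφ : ContDiff ℝ ∞ φ) (i : Fin n)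
    (k : ℕ) : ContDiff ℝ ∞ ((_root_.partialD i)^[k] φ) := by
  induction k with
  | zero => exact hφ
  | succ k ih => rw [Function.iterate_succ_apply']; exact ih.partialD i

theorem partialD_comm {n : ℕ} {φ : Rn n → ℝ} (hφ : ContDiff ℝ ∞ φ) (i j : Fin n) :
    partialD i (partialD j φ) = partialD j (partialD i φ) := by
  have hd : Differentiable ℝ (fderiv ℝ φ) :=
    ((contDiff_infty.1 hφ 2).fderiv_right (m := 1) (by norm_num)).differentiable one_ne_zero
  have key : ∀ (k m : Fin n) (x : Rn n), partialD k (partialD m φ) x =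
      fderiv ℝ (fderiv ℝ φ) x (EuclideanSpace.single k 1) (EuclideanSpace.single m 1) := by
    intro k m x
    change fderiv ℝ (fun y => fderiv ℝ φ y (EuclideanSpace.single m 1)) x _ = _
    rw [fderiv_clm_apply (hd x) (differentiableAt_const _)]
    simp
  funext x
  rw [key, key]
  exact ((contDiff_infty.1 hφ 2).contDiffAt.isSymmSndFDerivAt (by simp)) _ _

theorem partialD_iterate_comm {n : ℕ} {φ : Rn n → ℝ} (hφ : ContDiff ℝ ∞ φ) (i j : Fin n) (k : ℕ) :
    partialD i ((partialD j)^[k] φ) = (partialD j)^[k] (partialD i φ) := by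
  induction k with
  | zero => rfl
  | succ k ih =>
    rw [Function.iterate_succ_apply', Function.iterate_succ_apply',
      partialD_comm (hφ.iterate_partialD j k), ih]

/-- The part of `multiD α φ` that involves only the variables listed in `L`. -/
noncomputable def multiDList {n : ℕ} (α : Fin n → ℕ) (L : List (Fin n)) (φ : Rn n → ℝ) :
    Rn n → ℝ :=
  L.foldr (fun i g => (partialD i)^[α i] g) φ

theorem contDiff_multiDList {n : ℕ} (α : Fin n → ℕ) (L : List (Fin n)) {φ : Rn n → ℝ}
    (hφ : ContDiff ℝ ∞ φ) : ContDiff ℝ ∞ (multiDList α L φ) := by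
  induction L with
  | nil => exact hφ
  | cons k t ih => exact ih.iterate_partialD k _

theorem partialD_multiDList {n : ℕ} (α : Fin n → ℕ) (L : List (Fin n)) {φ : Rn n → ℝ}
    (hφ : ContDiff ℝ ∞ φ) (i : Fin n) :
    partialD i (multiDList α L φ) = multiDList α L (partialD i φ) := by
  induction L with
  | nil => rfl
  | cons k t ih =>
    change partialD i ((partialD k)^[α k] (multiDList α t φ)) =
      (partialD k)^[α k] (multiDList α t (partialD i φ))
    rw [partialD_iterate_comm (contDiff_multiDList α t hφ), ih]

theorem multiDList_add_single_of_notMem {n : ℕ} (α : Fin n → ℕ) {L : List (Fin n)} (φ : Rn n → ℝ)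
    {i : Fin n} (hi : i ∉ L) : multiDList (α + Pi.single i 1) L φ = multiDList α L φ := by
  induction L with
  | nil => rfl
  | cons k t ih =>
    rw [List.mem_cons, not_or] at hi
    change (partialD k)^[(α + Pi.single i 1 : Fin n → ℕ) k] (multiDList (α + Pi.single i 1) t φ) =
      (partialD k)^[α k] (multiDList α t φ)
    rw [ih hi.2, Pi.add_apply, Pi.single_eq_of_ne (Ne.symm hi.1), add_zero]

theorem multiDList_add_single {n : ℕ} (α : Fin n → ℕ) {L : List (Fin n)} (hL : L.Nodup)
    {φ : Rn n → ℝ} (hφ : ContDiff ℝ ∞ φ) {i : Fin n} (hi : i ∈ L) :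
    multiDList (α + Pi.single i 1) L φ = multiDList α L (partialD i φ) := by
  induction L with
  | nil => simp at hi
  | cons k t ih =>
    rw [List.nodup_cons] at hL
    change (partialD k)^[(α + Pi.single i 1 : Fin n → ℕ) k] (multiDList (α + Pi.single i 1) t φ) =
      (partialD k)^[α k] (multiDList α t (partialD i φ))
    by_cases hk : i = k
    · subst hk
      rw [multiDList_add_single_of_notMem α φ hL.1, Pi.add_apply, Pi.single_eq_same,
        Function.iterate_succ_apply, partialD_multiDList α t hφ]
    · rw [ih hL.2 ((List.mem_cons.1 hi).resolve_left hk), Pi.add_apply,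
        Pi.single_eq_of_ne (Ne.symm hk), add_zero]

theorem contDiff_multiD {n : ℕ} (α : Fin n → ℕ) {φ : Rn n → ℝ} (hφ : ContDiff ℝ ∞ φ) :
    ContDiff ℝ ∞ (multiD α φ) :=
  contDiff_multiDList α _ hφ

theorem partialD_multiD {n : ℕ} (α : Fin n → ℕ) {φ : Rn n → ℝ} (hφ : ContDiff ℝ ∞ φ)
    (i : Fin n) : partialD i (multiD α φ) = multiD α (partialD i φ) :=
  partialD_multiDList α _ hφ i

theorem multiD_add_single {n : ℕ} (α : Fin n → ℕ) {φ : Rn n → ℝ} (hφ : ContDiff ℝ ∞ φ)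
    (i : Fin n) : multiD (α + Pi.single i 1) φ = multiD α (partialD i φ) :=
  multiDList_add_single α (List.nodup_finRange n) hφ (List.mem_finRange i)

theorem multiD_zero {n : ℕ} (φ : Rn n → ℝ) : multiD 0 φ = φ := by
  unfold multiD
  induction List.finRange n with
  | nil => rfl
  | cons k t ih => rw [List.foldr_cons, ih]; rfl

theorem tsupport_partialD_subset {n : ℕ} (φ : Rn n → ℝ) (i : Fin n) :
    tsupport (partialD i φ) ⊆ tsupport φ :=
  tsupport_fderiv_apply_subset ℝ _

theorem tsupport_multiD_subset {n : ℕ} (α : Fin n → ℕ) (φ : Rn n → ℝ) :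
    tsupport (multiD α φ) ⊆ tsupport φ := by
  unfold multiD
  induction List.finRange n with
  | nil => exact subset_rfl
  | cons k t ih =>
    rw [List.foldr_cons]
    have h : ∀ (m : ℕ) (g : Rn n → ℝ), tsupport ((partialD k)^[m] g) ⊆ tsupport g := by
      intro m g
      induction m with
      | zero => exact subset_rfl
      | succ m ihm =>
        rw [Function.iterate_succ_apply']
        exact (tsupport_partialD_subset _ k).trans ihm
    exact (h _ _).trans ih

theorem IsTestFunction.mono {n : ℕ} {Ω : Set (Rn n)} {φ ψ : Rn n → ℝ} (hφ : IsTestFunction Ω φ)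
    (hψ : ContDiff ℝ ∞ ψ) (h : tsupport ψ ⊆ tsupport φ) : IsTestFunction Ω ψ :=
  ⟨hψ, hφ.2.1.of_isClosed_subset (isClosed_tsupport _) h, h.trans hφ.2.2⟩

theorem IsTestFunction.partialD {n : ℕ} {Ω : Set (Rn n)} {φ : Rn n → ℝ} (hφ : IsTestFunction Ω φ)
    (i : Fin n) : IsTestFunction Ω (partialD i φ) :=
  hφ.mono (hφ.1.partialD i) (tsupport_partialD_subset φ i)

theorem IsTestFunction.multiD {n : ℕ} {Ω : Set (Rn n)} {φ : Rn n → ℝ} (hφ : IsTestFunction Ω φ)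
    (α : Fin n → ℕ) : IsTestFunction Ω (multiD α φ) :=
  hφ.mono (contDiff_multiD α hφ.1) (tsupport_multiD_subset α φ)

/-- `g` is the weak partial derivative `∂f/∂xᵢ` in `Ω`. This is `HasWeakD` for the multi-index
`eᵢ`, with the derivative of the test function written as `partialD i φ`. -/
def HasWeakPartial {n : ℕ} (Ω : Set (Rn n)) (i : Fin n) (f g : Rn n → ℝ) : Prop :=
  LocallyIntegrableOn f Ω volume ∧ LocallyIntegrableOn g Ω volume ∧
    ∀ φ : Rn n → ℝ, IsTestFunction Ω φ →
      ∫ x in Ω, f x * partialD i φ x = - ∫ x in Ω, g x * φ x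

theorem sum_add_single {n : ℕ} (α : Fin n → ℕ) (i : Fin n) :
    ∑ k, (α + Pi.single i 1 : Fin n → ℕ) k = ∑ k, α k + 1 := by
  simp [Finset.sum_add_distrib]

theorem hasWeakD_zero {n : ℕ} {Ω : Set (Rn n)} {f : Rn n → ℝ}
    (hf : LocallyIntegrableOn f Ω volume) : HasWeakD Ω 0 f f :=
  ⟨hf, hf, fun φ _ => by simp [multiD_zero]⟩

/-- If `g = D^α f` and `h = D^{α + eᵢ} f`, then `h = ∂ᵢ g`. -/
theorem HasWeakD.hasWeakPartial {n : ℕ} {Ω : Set (Rn n)} {α : Fin n → ℕ} {i : Fin n}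
    {f g h : Rn n → ℝ} (hg : HasWeakD Ω α f g) (hh : HasWeakD Ω (α + Pi.single i 1) f h) :
    HasWeakPartial Ω i g h := by
  refine ⟨hg.2.1, hh.2.1, fun φ hφ => ?_⟩
  have h1 := hg.2.2 _ (hφ.partialD i)
  have h2 := hh.2.2 _ hφ
  rw [multiD_add_single α hφ.1, h1, sum_add_single, pow_succ, mul_assoc] at h2
  have := mul_left_cancel₀ (pow_ne_zero _ (by norm_num)) h2
  simpa using this

/-- If `g = ∂ᵢ f` and `h = D^α g`, then `h = D^{α + eᵢ} f`. -/
theorem HasWeakPartial.hasWeakD_add_single {n : ℕ} {Ω : Set (Rn n)} {α : Fin n → ℕ} {i : Fin n}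
    {f g h : Rn n → ℝ} (hg : HasWeakPartial Ω i f g) (hh : HasWeakD Ω α g h) :
    HasWeakD Ω (α + Pi.single i 1) f h := by
  refine ⟨hg.1, hh.2.1, fun φ hφ => ?_⟩
  rw [multiD_add_single α hφ.1, ← partialD_multiD α hφ.1, hg.2.2 _ (hφ.multiD α), hh.2.2 φ hφ,
    sum_add_single, pow_succ]
  ring

/-- If `g = ∂ᵢ f` and `h = D^{α + eᵢ} f`, then `h = D^α g`. -/
theorem HasWeakPartial.hasWeakD {n : ℕ} {Ω : Set (Rn n)} {α : Fin n → ℕ} {i : Fin n}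
    {f g h : Rn n → ℝ} (hg : HasWeakPartial Ω i f g) (hh : HasWeakD Ω (α + Pi.single i 1) f h) :
    HasWeakD Ω α g h := by
  refine ⟨hg.2.1, hh.2.1, fun φ hφ => ?_⟩
  have h2 := hh.2.2 _ hφ
  rw [multiD_add_single α hφ.1, ← partialD_multiD α hφ.1, hg.2.2 _ (hφ.multiD α),
    sum_add_single, pow_succ] at h2
  linarith

/-- `f ∈ W^{k,1}_loc(Ω)`: all weak derivatives of order at most `k` exist as locally integrable
functions. -/
def MemSobolevOneLoc {n : ℕ} (Ω : Set (Rn n)) (k : ℕ) (f : Rn n → ℝ) : Prop :=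
  ∀ α : Fin n → ℕ, ∑ i, α i ≤ k → ∃ g : Rn n → ℝ, HasWeakD Ω α f g

theorem MemSobolevInftyLoc.memSobolevOneLoc {n : ℕ} {Ω : Set (Rn n)} {k : ℕ} {f : Rn n → ℝ}
    (hf : MemSobolevInftyLoc Ω k f) : MemSobolevOneLoc Ω k f :=
  fun α hα => (hf α hα).imp fun _ h => h.1

theorem MemSobolevOneLoc.mono {n : ℕ} {Ω : Set (Rn n)} {k m : ℕ} {f : Rn n → ℝ}
    (hf : MemSobolevOneLoc Ω k f) (h : m ≤ k) : MemSobolevOneLoc Ω m f :=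
  fun α hα => hf α (hα.trans h)

theorem MemSobolevOneLoc.locallyIntegrableOn {n : ℕ} {Ω : Set (Rn n)} {k : ℕ} {f : Rn n → ℝ}
    (hf : MemSobolevOneLoc Ω k f) : LocallyIntegrableOn f Ω volume := by
  obtain ⟨g, hg⟩ := hf 0 (by simp)
  exact hg.1

theorem memSobolevOneLoc_zero {n : ℕ} {Ω : Set (Rn n)} {f : Rn n → ℝ}
    (hf : LocallyIntegrableOn f Ω volume) : MemSobolevOneLoc Ω 0 f := by
  intro α hα
  obtain rfl : α = 0 := by
    funext i
    simpa using (Finset.sum_eq_zero_iff.1 (Nat.le_zero.1 hα)) i (Finset.mem_univ i)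
  exact ⟨f, hasWeakD_zero hf⟩

theorem memSobolevOneLoc_succ {n : ℕ} {Ω : Set (Rn n)} {k : ℕ} {f : Rn n → ℝ} :
    MemSobolevOneLoc Ω (k + 1) f ↔ LocallyIntegrableOn f Ω volume ∧
      ∀ i, ∃ g, HasWeakPartial Ω i f g ∧ MemSobolevOneLoc Ω k g := by
  constructor
  · refine fun hf => ⟨hf.locallyIntegrableOn, fun i => ?_⟩
    obtain ⟨g, hg⟩ := hf (0 + Pi.single i 1) (by rw [sum_add_single]; simp)
    have hp := (hasWeakD_zero hf.locallyIntegrableOn).hasWeakPartial hg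
    refine ⟨g, hp, fun α hα => ?_⟩
    obtain ⟨h, hh⟩ := hf (α + Pi.single i 1) (by rw [sum_add_single]; omega)
    exact ⟨h, hp.hasWeakD hh⟩
  · rintro ⟨hf, hg⟩ α hα
    by_cases h0 : α = 0
    · exact ⟨f, h0 ▸ hasWeakD_zero hf⟩
    · obtain ⟨i, hi⟩ := Function.ne_iff.1 h0
      have hα' : α = (α - Pi.single i 1) + Pi.single i 1 := by
        funext m
        by_cases hm : m = i
        · subst hm
          simp only [Pi.zero_apply] at hi
          simp only [Pi.add_apply, Pi.sub_apply, Pi.single_eq_same]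
          omega
        · simp [Pi.single_eq_of_ne hm]
      rw [hα'] at hα ⊢
      rw [sum_add_single] at hα
      obtain ⟨g, hp, hW⟩ := hg i
      obtain ⟨h, hh⟩ := hW _ (Nat.le_of_succ_le_succ hα)
      exact ⟨h, hp.hasWeakD_add_single hh⟩

/-! ### Convolution with Lipschitz kernels, and Lipschitz test functions -/

section
open Filter Topology Metric Set
open scoped Convolution

/-- Rademacher's theorem allows differentiation of `∫ f(y) K(x - y) dy` under the integral sign for
an integrable `f` and a kernel `K` that is only Lipschitz: for fixed `x` the kernel is
differentiable at `x - y` for almost every `y`. -/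
theorem hasFDerivAt_integral_mul_comp_sub {n : ℕ} {f K : Rn n → ℝ} (hf : Integrable f)
    {C : NNReal} (hK : LipschitzWith C K) {M : ℝ} (hM : ∀ x, |K x| ≤ M) (x : Rn n) :
    Integrable (fun y => f y • fderiv ℝ K (x - y)) ∧
    HasFDerivAt (fun x => ∫ y, f y * K (x - y)) (∫ y, f y • fderiv ℝ K (x - y)) x := by
  have hKx : ∀ x : Rn n, Continuous fun y => K (x - y) := fun x =>
    hK.continuous.comp (continuous_const.sub continuous_id)
  refine hasFDerivAt_integral_of_dominated_loc_of_lip (bound := fun y => C * ‖f y‖) (s := univ)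
    univ_mem ?_ ?_ ?_ ?_ (hf.norm.const_mul _) ?_
  · exact Eventually.of_forall fun x => hf.1.mul (hKx x).aestronglyMeasurable
  · exact hf.mul_bdd (c := M) (hKx x).aestronglyMeasurable (Eventually.of_forall fun y => hM _)
  · refine hf.1.smul ?_
    exact ((measurable_fderiv ℝ K).comp (measurable_const.sub measurable_id)).aestronglyMeasurable
  · refine Eventually.of_forall fun y => LipschitzOnWith.of_dist_le_mul fun a _ b _ => ?_
    rw [Real.dist_eq, ← mul_sub, abs_mul, Real.coe_nnabs,
      abs_of_nonneg (mul_nonneg C.coe_nonneg (norm_nonneg (f y)))]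
    have := hK.dist_le_mul (a - y) (b - y)
    rw [dist_sub_right, Real.dist_eq] at this
    calc |f y| * |K (a - y) - K (b - y)| ≤ |f y| * (C * dist a b) := by gcongr
      _ = C * ‖f y‖ * dist a b := by rw [Real.norm_eq_abs]; ring
  · have h := (Measure.measurePreserving_sub_left volume x).quasiMeasurePreserving.ae
      (hK.ae_differentiableAt (μ := volume))
    filter_upwards [h] with y hy
    have h1 : HasFDerivAt (fun z => K (z - y)) (fderiv ℝ K (x - y)) x := by
      have := hy.hasFDerivAt.comp x ((hasFDerivAt_id x).sub_const y)
      simpa [Function.comp_def] using! this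
    simpa using! h1.const_mul (f y)

/-- A convolution `∫ f(y) G(x - y) dy` of an integrable with a bounded measurable function is
continuous. -/
theorem continuous_integral_mul_comp_sub {n : ℕ} {f G : Rn n → ℝ} (hf : Integrable f)
    (hG : Measurable G) {M : ℝ} (hM : ∀ x, |G x| ≤ M) :
    Continuous fun x => ∫ y, f y * G (x - y) := by
  have hM0 : 0 ≤ M := (abs_nonneg _).trans (hM 0)
  have hGx : ∀ x : Rn n, AEStronglyMeasurable (fun y => G (x - y)) volume := fun x =>
    (hG.comp (measurable_const.sub measurable_id)).aestronglyMeasurable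
  have hint : ∀ {g : Rn n → ℝ}, Integrable g → ∀ x, Integrable fun y => g y * G (x - y) :=
    fun hg x => hg.mul_bdd (c := M) (hGx x) (Eventually.of_forall fun y => hM _)
  apply continuous_of_uniform_approx_of_continuous
  rw [Metric.uniformity_basis_dist_le.forall_iff (by
    intro s t hst ⟨F, hF, h⟩
    exact ⟨F, hF, fun y => hst (h y)⟩)]
  intro ε hε
  obtain ⟨g, hgc, hgε, hgcont, hgint⟩ :=
    hf.exists_hasCompactSupport_integral_sub_le (ε := ε / (M + 1)) (by positivity)
  refine ⟨fun x => ∫ y, g y * G (x - y), ?_, fun x => ?_⟩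
  · have hGl : LocallyIntegrable G volume := by
      refine (locallyIntegrable_const M).mono hG.aestronglyMeasurable
        (Eventually.of_forall fun x => ?_)
      rw [Real.norm_eq_abs, Real.norm_eq_abs, abs_of_nonneg hM0]
      exact hM x
    exact HasCompactSupport.continuous_convolution_left (f := g) (g := G) (μ := volume)
      (ContinuousLinearMap.mul ℝ ℝ) hgc hgcont hGl
  · simp only [Set.mem_ofPred_eq, Real.dist_eq]
    rw [← integral_sub (hint hf x) (hint hgint x)]
    calc |∫ y, (f y * G (x - y) - g y * G (x - y))|
        ≤ ∫ y, ‖f y - g y‖ * M := by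
          rw [← Real.norm_eq_abs]
          refine norm_integral_le_of_norm_le ((hf.sub hgint).norm.mul_const M)
            (Eventually.of_forall fun y => ?_)
          rw [← sub_mul, norm_mul]
          gcongr
          exact hM _
      _ ≤ ε / (M + 1) * M := by rw [integral_mul_const]; gcongr
      _ ≤ ε := by
          rw [div_mul_eq_mul_div, div_le_iff₀ (by positivity)]
          nlinarith

theorem clm_apply_eq_sum_single {n : ℕ} (L : Rn n →L[ℝ] ℝ) (y : Rn n) :
    L y = ∑ i, y i * L (EuclideanSpace.single i 1) := by
  conv_lhs => rw [← (EuclideanSpace.basisFun (Fin n) ℝ).sum_repr y]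
  simp

theorem contDiffOn_succ_of_partialD {n : ℕ} {F : Rn n → ℝ} {U : Set (Rn n)} (hU : IsOpen U) {k : ℕ}
    (hd : DifferentiableOn ℝ F U) (h : ∀ i, ContDiffOn ℝ k (partialD i F) U) :
    ContDiffOn ℝ (k + 1) F U := by
  rw [contDiffOn_succ_iff_fderiv_of_isOpen hU]
  refine ⟨hd, by simp, contDiffOn_clm_apply.2 fun y => ?_⟩
  have : (fun x => fderiv ℝ F x y) = fun x => ∑ i, y i * partialD i F x :=
    funext fun x => clm_apply_eq_sum_single _ y
  rw [this]
  exact ContDiffOn.sum fun i _ => contDiffOn_const.mul (h i)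

theorem abs_partialD_le {n : ℕ} {K : Rn n → ℝ} {C : NNReal} (hK : LipschitzWith C K) (i : Fin n)
    (x : Rn n) : |partialD i K x| ≤ C := by
  have h1 := (fderiv ℝ K x).le_opNorm (EuclideanSpace.single i 1)
  have h2 := norm_fderiv_le_of_lipschitz ℝ (x₀ := x) hK
  simpa [partialD] using h1.trans (mul_le_mul_of_nonneg_right h2 (norm_nonneg _))

theorem measurable_partialD {n : ℕ} (K : Rn n → ℝ) (i : Fin n) : Measurable (partialD i K) :=
  measurable_fderiv_apply_const ℝ K _

theorem partialD_integral_mul_comp_sub {n : ℕ} {f K : Rn n → ℝ} (hf : Integrable f)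
    {C : NNReal} (hK : LipschitzWith C K) {M : ℝ} (hM : ∀ x, |K x| ≤ M) (i : Fin n) (x : Rn n) :
    partialD i (fun x => ∫ y, f y * K (x - y)) x = ∫ y, f y * partialD i K (x - y) := by
  obtain ⟨h1, h2⟩ := hasFDerivAt_integral_mul_comp_sub hf hK hM x
  rw [partialD, h2.fderiv, ContinuousLinearMap.integral_apply h1]
  rfl

theorem contDiff_one_integral_mul_comp_sub {n : ℕ} {f K : Rn n → ℝ} (hf : Integrable f)
    {C : NNReal} (hK : LipschitzWith C K) {M : ℝ} (hM : ∀ x, |K x| ≤ M) :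
    ContDiff ℝ 1 (fun x => ∫ y, f y * K (x - y)) := by
  rw [← contDiffOn_univ]
  have := contDiffOn_succ_of_partialD (k := 0) (F := fun x => ∫ y, f y * K (x - y)) isOpen_univ
    (fun x _ =>
      (hasFDerivAt_integral_mul_comp_sub hf hK hM x).2.differentiableAt.differentiableWithinAt)
    (fun i => ?_)
  · simpa using this
  · simp only [CharP.cast_eq_zero, contDiffOn_zero, continuousOn_univ]
    rw [funext (partialD_integral_mul_comp_sub hf hK hM i)]
    exact continuous_integral_mul_comp_sub hf (measurable_partialD K i) (abs_partialD_le hK i)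

/-- Mollification: a compactly supported Lipschitz function is a pointwise limit of test functions,
uniformly bounded and supported in a common compact set, whose partial derivatives are uniformly
bounded and converge almost everywhere. -/
theorem exists_testFunction_tendsto {n : ℕ} {Ω : Set (Rn n)} (hΩ : IsOpen Ω) {ψ : Rn n → ℝ}
    {C : NNReal} (hψ : LipschitzWith C ψ) (hc : HasCompactSupport ψ) (hs : tsupport ψ ⊆ Ω)
    (i : Fin n) :
    ∃ (φ : ℕ → Rn n → ℝ) (T : Set (Rn n)) (M : ℝ), IsCompact T ∧ T ⊆ Ω ∧
      (∀ k, IsTestFunction Ω (φ k)) ∧ (∀ k, tsupport (φ k) ⊆ T) ∧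
      (∀ k x, |φ k x| ≤ M) ∧ (∀ k x, |partialD i (φ k) x| ≤ M) ∧
      (∀ x, Tendsto (fun k => φ k x) atTop (𝓝 (ψ x))) ∧
      ∀ᵐ x, Tendsto (fun k => partialD i (φ k) x) atTop (𝓝 (partialD i ψ x)) := by
  obtain ⟨δ, hδ, hδΩ⟩ := hc.isCompact.exists_cthickening_subset_open hΩ hs
  obtain ⟨M, hM⟩ := hc.exists_bound_of_continuous hψ.continuous
  let η : ℕ → ContDiffBump (0 : Rn n) := fun k =>
    { rIn := δ / (2 * (k + 1))
      rOut := δ / (k + 1)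
      rIn_pos := by positivity
      rIn_lt_rOut := by
        apply div_lt_div_of_pos_left hδ (by positivity)
        nlinarith [(Nat.cast_nonneg k : (0:ℝ) ≤ k)] }
  have hη_le : ∀ k, (η k).rOut ≤ δ := fun k =>
    div_le_self hδ.le (by linarith [(Nat.cast_nonneg k : (0:ℝ) ≤ k)])
  have hη_lim : Tendsto (fun k => (η k).rOut) atTop (𝓝 0) := by
    have := (tendsto_one_div_add_atTop_nhds_zero_nat (𝕜 := ℝ)).const_mul δ
    simpa [η, mul_one_div, div_eq_mul_inv] using this
  let e : ℕ → Rn n → ℝ := fun k => (η k).normed volume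
  have he_int : ∀ k, Integrable (e k) := fun k => (η k).integrable_normed
  have hdiff : LocallyIntegrable (partialD i ψ) volume := by
    refine (locallyIntegrable_const (C : ℝ)).mono (measurable_partialD ψ i).aestronglyMeasurable
      (Eventually.of_forall fun x => ?_)
    rw [Real.norm_eq_abs, Real.norm_eq_abs, abs_of_nonneg C.coe_nonneg]
    exact abs_partialD_le hψ i x
  have hbound : ∀ (k : ℕ) (G : Rn n → ℝ) (B : ℝ), (∀ x, |G x| ≤ B) → ∀ x,
      |∫ y, e k y * G (x - y)| ≤ B := by
    intro k G B hB x
    have : |∫ y, e k y * G (x - y)| ≤ ∫ y, e k y * B := by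
      rw [← Real.norm_eq_abs]
      refine norm_integral_le_of_norm_le ((he_int k).mul_const B)
        (Eventually.of_forall fun y => ?_)
      rw [norm_mul, Real.norm_eq_abs, abs_of_nonneg ((η k).nonneg_normed y)]
      exact mul_le_mul_of_nonneg_left (hB _) ((η k).nonneg_normed y)
    rwa [integral_mul_const, (η k).integral_normed, one_mul] at this
  have hsupp : ∀ k, tsupport (fun x => ∫ y, e k y * ψ (x - y)) ⊆ cthickening δ (tsupport ψ) := by
    intro k
    refine closure_minimal (fun x hx => ?_) isClosed_cthickening
    obtain ⟨y, hy⟩ : ∃ y, e k y * ψ (x - y) ≠ 0 := by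
      by_contra! h
      exact hx (by simp [h])
    have h1 : y ∈ ball (0 : Rn n) (η k).rOut := by
      rw [← (η k).support_normed_eq (μ := volume)]
      exact left_ne_zero_of_mul hy
    refine mem_cthickening_of_dist_le x (x - y) δ _ (subset_tsupport _ (right_ne_zero_of_mul hy)) ?_
    rw [mem_ball_zero_iff] at h1
    rw [dist_eq_norm, sub_sub_cancel]
    exact h1.le.trans (hη_le k)
  have hT : IsCompact (cthickening δ (tsupport ψ)) := hc.isCompact.cthickening
  have hM0 : ∀ x, |ψ x| ≤ M := hM
  refine ⟨fun k x => ∫ y, e k y * ψ (x - y), cthickening δ (tsupport ψ), max M C, hT, hδΩ,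
    fun k => ⟨?_, ?_, (hsupp k).trans hδΩ⟩, hsupp, ?_, ?_, ?_, ?_⟩
  · exact (η k).hasCompactSupport_normed.contDiff_convolution_left (ContinuousLinearMap.mul ℝ ℝ)
      (η k).contDiff_normed hψ.continuous.locallyIntegrable
  · exact hT.of_isClosed_subset (isClosed_tsupport _) (hsupp k)
  · exact fun k x => (hbound k ψ M hM0 x).trans (le_max_left _ _)
  · intro k x
    rw [partialD_integral_mul_comp_sub (he_int k) hψ hM0]
    exact (hbound k _ C (abs_partialD_le hψ i) x).trans (le_max_right _ _)
  · exact fun x => ContDiffBump.convolution_tendsto_right_of_continuous (μ := volume) hη_lim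
      hψ.continuous x
  · have := ContDiffBump.ae_convolution_tendsto_right_of_locallyIntegrable (K := 2) hη_lim
      (Eventually.of_forall fun k => ?_) hdiff
    · filter_upwards [this] with x hx
      simp_rw [partialD_integral_mul_comp_sub (he_int _) hψ hM0]
      exact hx
    · change δ / (k + 1) ≤ 2 * (δ / (2 * (k + 1)))
      apply le_of_eq
      field_simp

/-- The defining identity of a weak partial derivative extends to compactly supported Lipschitz
test functions. -/
theorem HasWeakPartial.integral_mul_partialD {n : ℕ} {Ω : Set (Rn n)} (hΩ : IsOpen Ω) {i : Fin n}
    {f g : Rn n → ℝ} (h : HasWeakPartial Ω i f g) {ψ : Rn n → ℝ} {C : NNReal}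
    (hψ : LipschitzWith C ψ) (hc : HasCompactSupport ψ) (hs : tsupport ψ ⊆ Ω) :
    ∫ x in Ω, f x * partialD i ψ x = - ∫ x in Ω, g x * ψ x := by
  obtain ⟨φ, T, M, hT, hTΩ, hφ, hφT, hφM, hdM, hφlim, hdlim⟩ :=
    exists_testFunction_tendsto hΩ hψ hc hs i
  -- Dominated convergence on the common compact support.
  have key : ∀ (F : Rn n → ℝ) (H : ℕ → Rn n → ℝ) (G : Rn n → ℝ), LocallyIntegrableOn F Ω volume →
      (∀ k, Continuous (H k)) → (∀ k x, |H k x| ≤ M) → (∀ k, tsupport (H k) ⊆ T) →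
      (∀ᵐ x, Tendsto (fun k => H k x) atTop (𝓝 (G x))) →
      Tendsto (fun k => ∫ x in Ω, F x * H k x) atTop (𝓝 (∫ x in Ω, F x * G x)) := by
    intro F H G hF hH hHM hHT hlim
    have hFT : IntegrableOn F T volume := hF.integrableOn_compact_subset hTΩ hT
    refine tendsto_integral_of_dominated_convergence (fun x => T.indicator (fun x => ‖F x‖ * M) x)
      (fun k => ?_) ?_ (fun k => ?_) ?_
    · exact (hF.aestronglyMeasurable).mul (hH k).aestronglyMeasurable
    · have h : IntegrableOn (fun x => ‖F x‖ * M) T volume := hFT.norm.mul_const M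
      exact (h.integrable_indicator hT.measurableSet).integrableOn
    · refine Eventually.of_forall fun x => ?_
      by_cases hx : x ∈ T
      · rw [indicator_of_mem hx, norm_mul]
        exact mul_le_mul_of_nonneg_left (hHM k x) (norm_nonneg _)
      · rw [indicator_of_notMem hx, image_eq_zero_of_notMem_tsupport fun hx' => hx (hHT k hx')]
        simp
    · filter_upwards [ae_restrict_of_ae hlim] with x hx
      exact hx.const_mul _
  have h1 := key f (fun k => partialD i (φ k)) (partialD i ψ) h.1
    (fun k => ((hφ k).1.partialD i).continuous) hdM
    (fun k => (tsupport_partialD_subset _ i).trans (hφT k)) hdlim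
  have h2 := key g φ ψ h.2.1 (fun k => (hφ k).1.continuous) hφM hφT
    (Eventually.of_forall hφlim)
  refine tendsto_nhds_unique h1 ?_
  simp_rw [fun k => h.2.2 _ (hφ k)]
  exact h2.neg

end

/-! ### Products and convolutions of Sobolev functions -/

section
open Filter Topology Metric Set

theorem MeasureTheory.LocallyIntegrableOn.integrableOn_mul {n : ℕ} {Ω : Set (Rn n)}
    {f ψ : Rn n → ℝ} (hf : LocallyIntegrableOn f Ω volume) (hψ : Continuous ψ)
    (hc : HasCompactSupport ψ) (hs : tsupport ψ ⊆ Ω) :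
    IntegrableOn (fun x => f x * ψ x) Ω volume := by
  have h1 : IntegrableOn (fun x => f x * ψ x) (tsupport ψ) volume :=
    (hf.integrableOn_compact_subset hs hc.isCompact).mul_continuousOn hψ.continuousOn hc.isCompact
  refine (h1.integrable_of_forall_notMem_eq_zero fun x hx => ?_).integrableOn
  rw [image_eq_zero_of_notMem_tsupport hx, mul_zero]

theorem contDiff_mul_of_tsupport_subset {n : ℕ} {Ω : Set (Rn n)} (hΩ : IsOpen Ω)
    {u φ : Rn n → ℝ} {k : WithTop ℕ∞} (hu : ContDiffOn ℝ k u Ω) (hφ : ContDiff ℝ k φ)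
    (hs : tsupport φ ⊆ Ω) : ContDiff ℝ k (fun x => u x * φ x) := by
  rw [contDiff_iff_contDiffAt]
  intro x
  by_cases hx : x ∈ tsupport φ
  · exact (hu.contDiffAt (hΩ.mem_nhds (hs hx))).mul hφ.contDiffAt
  · have h0 : (fun x => u x * φ x) =ᶠ[𝓝 x] fun _ => 0 := by
      filter_upwards [(isClosed_tsupport φ).isOpen_compl.mem_nhds hx] with y hy
      rw [image_eq_zero_of_notMem_tsupport hy, mul_zero]
    exact contDiffAt_const.congr_of_eventuallyEq h0

theorem ContDiffOn.partialD {n : ℕ} {Ω : Set (Rn n)} (hΩ : IsOpen Ω) {u : Rn n → ℝ} {k : ℕ}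
    (hu : ContDiffOn ℝ (k + 1 : ℕ) u Ω) (i : Fin n) : ContDiffOn ℝ k (partialD i u) Ω :=
  (hu.fderiv_of_isOpen hΩ (by norm_cast)).clm_apply contDiffOn_const

theorem partialD_mul {n : ℕ} {u f : Rn n → ℝ} {x : Rn n} (hu : DifferentiableAt ℝ u x)
    (hf : DifferentiableAt ℝ f x) (i : Fin n) :
    partialD i (fun y => u y * f y) x = u x * partialD i f x + f x * partialD i u x := by
  rw [partialD, fderiv_fun_mul hu hf]
  rfl

/-- The product rule for a `C¹` function and a weakly differentiable function. -/
theorem HasWeakPartial.mul {n : ℕ} {Ω : Set (Rn n)} (hΩ : IsOpen Ω) {i : Fin n}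
    {u f g : Rn n → ℝ} (hu : ContDiffOn ℝ 1 u Ω) (h : HasWeakPartial Ω i f g) :
    HasWeakPartial Ω i (fun x => u x * f x) (fun x => partialD i u x * f x + u x * g x) := by
  have hu' : ContinuousOn (_root_.partialD i u) Ω :=
    (ContDiffOn.partialD hΩ (k := 0) (by simpa using hu) i).continuousOn
  refine ⟨h.1.continuousOn_mul hu.continuousOn hΩ.isLocallyClosed,
    (h.1.continuousOn_mul hu' hΩ.isLocallyClosed).add
      (h.2.1.continuousOn_mul hu.continuousOn hΩ.isLocallyClosed), fun φ hφ => ?_⟩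
  have hφ1 : ContDiff ℝ 1 φ := contDiff_infty.1 hφ.1 1
  have hψ := contDiff_mul_of_tsupport_subset hΩ hu hφ1 hφ.2.2
  have hψs : tsupport (fun x => u x * φ x) ⊆ tsupport φ := tsupport_mul_subset_right
  have hψc : HasCompactSupport (fun x => u x * φ x) :=
    hφ.2.1.of_isClosed_subset (isClosed_tsupport _) hψs
  obtain ⟨C, hC⟩ := hψ.lipschitzWith_of_hasCompactSupport hψc one_ne_zero
  have key := h.integral_mul_partialD hΩ hC hψc (hψs.trans hφ.2.2)
  have hq : Continuous fun x => _root_.partialD i u x * φ x := by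
    have := contDiff_mul_of_tsupport_subset (k := 0) hΩ (contDiffOn_zero.2 hu')
      (contDiff_zero.2 hφ1.continuous) hφ.2.2
    exact this.continuous
  have hqs : tsupport (fun x => _root_.partialD i u x * φ x) ⊆ tsupport φ :=
    tsupport_mul_subset_right
  have hqc : HasCompactSupport (fun x => _root_.partialD i u x * φ x) :=
    hφ.2.1.of_isClosed_subset (isClosed_tsupport _) hqs
  have i1 := h.1.integrableOn_mul hq hqc (hqs.trans hφ.2.2)
  have i2 := h.2.1.integrableOn_mul hψ.continuous hψc (hψs.trans hφ.2.2)
  have hpψ : Continuous (_root_.partialD i fun x => u x * φ x) :=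
    (hψ.continuous_fderiv one_ne_zero).clm_apply continuous_const
  have i3 := h.1.integrableOn_mul hpψ
    (hψc.of_isClosed_subset (isClosed_tsupport _) (tsupport_partialD_subset _ i))
    ((tsupport_partialD_subset _ i).trans (hψs.trans hφ.2.2))
  have e1 : ∫ x in Ω, u x * f x * _root_.partialD i φ x =
      ∫ x in Ω, (f x * _root_.partialD i (fun x => u x * φ x) x -
        f x * (_root_.partialD i u x * φ x)) := by
    refine setIntegral_congr_fun hΩ.measurableSet fun x hx => ?_
    rw [partialD_mul ((hu.contDiffAt (hΩ.mem_nhds hx)).differentiableAt one_ne_zero)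
      (hφ1.differentiable one_ne_zero x)]
    ring
  have e2 : ∫ x in Ω, (_root_.partialD i u x * f x + u x * g x) * φ x =
      ∫ x in Ω, (f x * (_root_.partialD i u x * φ x) + g x * (u x * φ x)) :=
    integral_congr_ae (Eventually.of_forall fun x => by simp only; ring)
  rw [e1, e2, integral_sub i3 i1, integral_add i1 i2, key]
  ring

theorem MemSobolevOneLoc.add {n : ℕ} {Ω : Set (Rn n)} {k : ℕ} {f g : Rn n → ℝ}
    (hf : MemSobolevOneLoc Ω k f) (hg : MemSobolevOneLoc Ω k g) :
    MemSobolevOneLoc Ω k (fun x => f x + g x) := by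
  intro α hα
  obtain ⟨F, hF⟩ := hf α hα
  obtain ⟨G, hG⟩ := hg α hα
  refine ⟨fun x => F x + G x, hF.1.add hG.1, hF.2.1.add hG.2.1, fun φ hφ => ?_⟩
  have hD := hφ.multiD α
  simp_rw [add_mul]
  rw [integral_add (hF.1.integrableOn_mul hD.1.continuous hD.2.1 hD.2.2)
      (hG.1.integrableOn_mul hD.1.continuous hD.2.1 hD.2.2),
    integral_add (hF.2.1.integrableOn_mul hφ.1.continuous hφ.2.1 hφ.2.2)
      (hG.2.1.integrableOn_mul hφ.1.continuous hφ.2.1 hφ.2.2), hF.2.2 φ hφ, hG.2.2 φ hφ]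
  ring

theorem MemSobolevOneLoc.mul {n : ℕ} {Ω : Set (Rn n)} (hΩ : IsOpen Ω) {k : ℕ} :
    ∀ {u f : Rn n → ℝ}, ContDiffOn ℝ k u Ω → MemSobolevOneLoc Ω k f →
      MemSobolevOneLoc Ω k (fun x => u x * f x) := by
  induction k with
  | zero =>
    exact fun hu hf => memSobolevOneLoc_zero
      (hf.locallyIntegrableOn.continuousOn_mul hu.continuousOn hΩ.isLocallyClosed)
  | succ k ih =>
    intro u f hu hf
    obtain ⟨hf0, hf1⟩ := memSobolevOneLoc_succ.1 hf
    refine memSobolevOneLoc_succ.2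
      ⟨hf0.continuousOn_mul hu.continuousOn hΩ.isLocallyClosed, fun i => ?_⟩
    obtain ⟨g, hg, hgW⟩ := hf1 i
    exact ⟨_, hg.mul hΩ (hu.of_le (by norm_cast; omega)),
      (ih (ContDiffOn.partialD hΩ hu i) (hf.mono k.le_succ)).add
        (ih (hu.of_le (by norm_cast; omega)) hgW)⟩

theorem partialD_comp_const_sub {n : ℕ} (K : Rn n → ℝ) (i : Fin n) (x y : Rn n) :
    partialD i (fun y => K (x - y)) y = - partialD i K (x - y) := by
  unfold partialD
  have h := (ContinuousLinearEquiv.neg ℝ (M := Rn n)).comp_right_fderiv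
    (f := fun z => K (x + z)) (x := y)
  rw [fderiv_comp_add_left] at h
  simp only [Function.comp_def, ContinuousLinearEquiv.neg_apply, ← sub_eq_add_neg] at h
  rw [h]
  simp

/-- Convolution with a compactly supported Lipschitz kernel gains one derivative: if `f` has `k`
weak derivatives, then the convolution is of class `C^{k+1}`. One derivative falls on the kernel,
the others on `f`. The compact set `T` contains the points that are relevant for `x ∈ U`. -/
theorem MemSobolevOneLoc.contDiffOn_integral_mul_comp_sub {n : ℕ} {Ω : Set (Rn n)}
    (hΩ : IsOpen Ω) {K : Rn n → ℝ} {C : NNReal} (hK : LipschitzWith C K) {M : ℝ}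
    (hM : ∀ x, |K x| ≤ M) {U T : Set (Rn n)} (hU : IsOpen U) (hT : IsCompact T) (hTΩ : T ⊆ Ω)
    (hKT : ∀ x ∈ U, ∀ y, y ∉ T → K (x - y) = 0) {k : ℕ} :
    ∀ {f : Rn n → ℝ}, MemSobolevOneLoc Ω k f →
      ContDiffOn ℝ (k + 1) (fun x => ∫ y, f y * K (x - y)) U := by
  -- Only the values of `f` on `T` matter, and `f` is integrable there.
  have hcut : ∀ (f : Rn n → ℝ), ∀ x ∈ U,
      ∫ y, f y * K (x - y) = ∫ y, T.indicator f y * K (x - y) := by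
    intro f x hx
    congr 1
    funext y
    by_cases hy : y ∈ T
    · rw [indicator_of_mem hy]
    · rw [hKT x hx y hy]; simp
  have hbase : ∀ {f : Rn n → ℝ}, LocallyIntegrableOn f Ω volume →
      ContDiffOn ℝ 1 (fun x => ∫ y, f y * K (x - y)) U := by
    intro f hf
    have hfT : Integrable (T.indicator f) :=
      (hf.integrableOn_compact_subset hTΩ hT).integrable_indicator hT.measurableSet
    exact (contDiff_one_integral_mul_comp_sub hfT hK hM).contDiffOn.congr (hcut f)
  have hpart : ∀ {f g : Rn n → ℝ} {i : Fin n}, HasWeakPartial Ω i f g → ∀ x ∈ U,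
      partialD i (fun x => ∫ y, f y * K (x - y)) x = ∫ y, g y * K (x - y) := by
    intro f g i h x hx
    have hfT : Integrable (T.indicator f) :=
      (h.1.integrableOn_compact_subset hTΩ hT).integrable_indicator hT.measurableSet
    have e1 : partialD i (fun x => ∫ y, f y * K (x - y)) x =
        partialD i (fun x => ∫ y, T.indicator f y * K (x - y)) x := by
      unfold partialD
      rw [Filter.EventuallyEq.fderiv_eq]
      filter_upwards [hU.mem_nhds hx] with z hz using hcut f z hz
    have hsT : tsupport (fun y => K (x - y)) ⊆ T :=
      closure_minimal (fun y hy => by_contra fun hyT => hy (hKT x hx y hyT)) hT.isClosed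
    have hc : HasCompactSupport (fun y => K (x - y)) :=
      hT.of_isClosed_subset (isClosed_tsupport _) hsT
    have hL : LipschitzWith C (fun y => K (x - y)) := by
      refine LipschitzWith.of_dist_le_mul fun a b => ?_
      simpa only [dist_sub_left] using hK.dist_le_mul (x - a) (x - b)
    have key := h.integral_mul_partialD hΩ hL hc (hsT.trans hTΩ)
    rw [e1, partialD_integral_mul_comp_sub hfT hK hM]
    have hz : ∀ y, y ∉ T → partialD i (fun y => K (x - y)) y = 0 := fun y hy =>
      image_eq_zero_of_notMem_tsupport fun h' => hy (hsT (tsupport_partialD_subset _ i h'))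
    rw [setIntegral_eq_integral_of_forall_compl_eq_zero
        (fun y hy => by rw [hz y fun h' => hy (hTΩ h'), mul_zero]),
      setIntegral_eq_integral_of_forall_compl_eq_zero
        (fun y hy => by rw [hKT x hx y fun h' => hy (hTΩ h'), mul_zero])] at key
    rw [← neg_eq_iff_eq_neg.2 key, ← integral_neg]
    congr 1
    funext y
    by_cases hy : y ∈ T
    · rw [indicator_of_mem hy, partialD_comp_const_sub]; ring
    · rw [indicator_of_notMem hy, hz y hy]; simp
  induction k with
  | zero => exact fun hf => by simpa using hbase hf.locallyIntegrableOn
  | succ k ih =>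
    intro f hf
    obtain ⟨hf0, hf1⟩ := memSobolevOneLoc_succ.1 hf
    refine contDiffOn_succ_of_partialD hU ((hbase hf0).differentiableOn one_ne_zero) fun i => ?_
    obtain ⟨g, hg, hgW⟩ := hf1 i
    exact_mod_cast (ih hgW).congr (hpart hg)

end

/-! ### Norms on `ℝⁿ` and the mean value property -/

section
open Filter Topology Metric Set

theorem Seminorm.exists_lipschitzWith {n : ℕ} (N : Seminorm ℝ (Rn n)) :
    ∃ C : NNReal, LipschitzWith C N := by
  have h0 : ∀ i, 0 ≤ N (EuclideanSpace.single i 1) := fun i => apply_nonneg N _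
  have hle : ∀ x, N x ≤ (∑ i, N (EuclideanSpace.single i 1)) * ‖x‖ := by
    intro x
    conv_lhs => rw [← (EuclideanSpace.basisFun (Fin n) ℝ).sum_repr x]
    rw [Finset.sum_mul]
    refine (Finset.le_sum_of_subadditive N (map_zero N).le (map_add_le_add N) _ _).trans
      (Finset.sum_le_sum fun i _ => ?_)
    rw [map_smul_eq_mul, mul_comm]
    simp only [EuclideanSpace.basisFun_apply, EuclideanSpace.basisFun_repr]
    exact mul_le_mul_of_nonneg_left (PiLp.norm_apply_le x i) (h0 i)
  refine ⟨⟨∑ i, N (EuclideanSpace.single i 1), Finset.sum_nonneg fun i _ => h0 i⟩,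
    LipschitzWith.of_dist_le_mul fun x y => ?_⟩
  rw [Real.dist_eq, dist_eq_norm]
  exact (abs_sub_map_le_sub N x y).trans (hle _)

theorem Seminorm.continuous_Rn {n : ℕ} (N : Seminorm ℝ (Rn n)) : Continuous N :=
  N.exists_lipschitzWith.choose_spec.continuous

theorem Seminorm.measurableSet_ball_Rn {n : ℕ} (N : Seminorm ℝ (Rn n)) (x : Rn n) (r : ℝ) :
    MeasurableSet (N.ball x r) :=
  (isOpen_lt (N.continuous_Rn.comp (continuous_id.sub continuous_const))
    continuous_const).measurableSet

theorem Seminorm.exists_mul_norm_le {n : ℕ} (N : Seminorm ℝ (Rn n))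
    (hN : ∀ x : Rn n, N x = 0 → x = 0) : ∃ c : ℝ, 0 < c ∧ ∀ x, c * ‖x‖ ≤ N x := by
  rcases (sphere (0 : Rn n) 1).eq_empty_or_nonempty with h | h
  · refine ⟨1, one_pos, fun x => ?_⟩
    have hx : x = 0 := by
      by_contra hx
      have : ‖x‖⁻¹ • x ∈ sphere (0 : Rn n) 1 := by simp [norm_smul, hx]
      simp [h] at this
    simp [hx]
  · obtain ⟨z, hz, hmin⟩ := (isCompact_sphere (0 : Rn n) 1).exists_isMinOn h
      N.continuous_Rn.continuousOn
    have hz0 : z ≠ 0 := by rintro rfl; simp at hz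
    refine ⟨N z, (apply_nonneg N z).lt_of_ne fun h => hz0 (hN z h.symm), fun x => ?_⟩
    by_cases hx : x = 0
    · simp [hx]
    · have hx' : 0 < ‖x‖ := norm_pos_iff.2 hx
      have h1 := hmin (show ‖x‖⁻¹ • x ∈ sphere (0 : Rn n) 1 by simp [norm_smul, hx])
      simp only [Set.mem_ofPred_eq, map_smul_eq_mul, norm_inv, norm_norm] at h1
      rwa [inv_mul_eq_div, le_div_iff₀ hx'] at h1

/-- Around a compact subset of `Ω` all `N`-balls of a small fixed radius stay in a common compact
subset of `Ω`. -/
theorem Seminorm.exists_isCompact_ball_subset {n : ℕ} (N : Seminorm ℝ (Rn n))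
    (hN : ∀ x : Rn n, N x = 0 → x = 0) {S Ω : Set (Rn n)} (hΩ : IsOpen Ω) (hS : IsCompact S)
    (hSΩ : S ⊆ Ω) :
    ∃ R : ℝ, 0 < R ∧ ∃ T, IsCompact T ∧ T ⊆ Ω ∧ ∀ x ∈ S, ∀ y, N (y - x) ≤ R → y ∈ T := by
  obtain ⟨c, hc, hcN⟩ := N.exists_mul_norm_le hN
  obtain ⟨δ, hδ, hδΩ⟩ := hS.exists_cthickening_subset_open hΩ hSΩ
  refine ⟨c * δ, by positivity, _, hS.cthickening, hδΩ, fun x hx y hy => ?_⟩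
  refine mem_cthickening_of_dist_le y x δ S hx ?_
  rw [dist_eq_norm]
  exact le_of_mul_le_mul_left ((hcN _).trans hy) hc

theorem compactlyContained_ball {n : ℕ} {N : Seminorm ℝ (Rn n)} {T Ω : Set (Rn n)}
    (hT : IsCompact T) (hTΩ : T ⊆ Ω) {x : Rn n} {r : ℝ} (h : N.ball x r ⊆ T) :
    CompactlyContained (N.ball x r) Ω :=
  have h' := closure_minimal h hT.isClosed
  ⟨hT.of_isClosed_subset isClosed_closure h', h'.trans hTΩ⟩

theorem setIntegral_pos_of_ae_pos {n : ℕ} {s : Set (Rn n)} {f : Rn n → ℝ}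
    (hs : volume s ≠ 0) (hf : ∀ᵐ x ∂(volume.restrict s), 0 < f x)
    (hi : IntegrableOn f s volume) : 0 < ∫ x in s, f x := by
  rw [integral_pos_iff_support_of_nonneg_ae (hf.mono fun x hx => hx.le) hi]
  have : (volume.restrict s) (Function.support f) = (volume.restrict s) univ :=
    measure_congr (hf.mono fun x hx => by
      simp only [eq_iff_iff]
      exact ⟨fun _ => trivial, fun _ => hx.ne'⟩)
  rw [this, Measure.restrict_apply_univ]
  exact pos_iff_ne_zero.2 hs

theorem Seminorm.volume_ball_ne_zero {n : ℕ} (N : Seminorm ℝ (Rn n)) (x : Rn n) {r : ℝ}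
    (hr : 0 < r) : volume (N.ball x r) ≠ 0 := by
  refine (IsOpen.measure_pos volume ?_ ⟨x, N.mem_ball_self hr⟩).ne'
  exact isOpen_lt (N.continuous_Rn.comp (continuous_id.sub continuous_const)) continuous_const

theorem weightedMeasure_restrict {n : ℕ} {Ω s : Set (Rn n)} (hs : MeasurableSet s) (hsΩ : s ⊆ Ω)
    (w : Rn n → ℝ) : (weightedMeasure Ω w).restrict s =
      (volume.restrict s).withDensity (fun x => ENNReal.ofReal (w x)) := by
  rw [weightedMeasure, restrict_withDensity hs, Measure.restrict_restrict hs,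
    inter_eq_self_of_subset_left hsΩ]

theorem setIntegral_weightedMeasure {n : ℕ} {Ω s : Set (Rn n)} (hs : MeasurableSet s)
    (hsΩ : s ⊆ Ω) {w : Rn n → ℝ} (hw_int : LocallyIntegrableOn w Ω volume)
    (hw_pos : ∀ᵐ x ∂(volume.restrict Ω), 0 < w x) (g : Rn n → ℝ) :
    ∫ x in s, g x ∂(weightedMeasure Ω w) = ∫ x in s, g x * w x := by
  rw [weightedMeasure_restrict hs hsΩ, integral_withDensity_eq_integral_toReal_smul₀
    (hw_int.aestronglyMeasurable.mono_set hsΩ).aemeasurable.ennreal_ofReal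
    (Eventually.of_forall fun x => ENNReal.ofReal_lt_top)]
  refine integral_congr_ae ?_
  filter_upwards [ae_restrict_of_ae_restrict_of_subset hsΩ hw_pos] with x hx
  rw [ENNReal.toReal_ofReal hx.le, smul_eq_mul, mul_comm]

theorem locallyIntegrableOn_mul_of_weightedMeasure {n : ℕ} {Ω : Set (Rn n)} (hΩ : IsOpen Ω)
    {w : Rn n → ℝ} (hw_int : LocallyIntegrableOn w Ω volume)
    (hw_pos : ∀ᵐ x ∂(volume.restrict Ω), 0 < w x) {u : Rn n → ℝ}
    (hu : LocallyIntegrableOn u Ω (weightedMeasure Ω w)) :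
    LocallyIntegrableOn (fun x => u x * w x) Ω volume := by
  rw [locallyIntegrableOn_iff hΩ.isLocallyClosed] at hu ⊢
  intro T hTΩ hT
  have h := hu T hTΩ hT
  rw [IntegrableOn, weightedMeasure_restrict hT.measurableSet hTΩ,
    integrable_withDensity_iff_integrable_smul₀'
    (hw_int.aestronglyMeasurable.mono_set hTΩ).aemeasurable.ennreal_ofReal
    (Eventually.of_forall fun x => ENNReal.ofReal_lt_top)] at h
  refine h.congr ?_
  filter_upwards [ae_restrict_of_ae_restrict_of_subset hTΩ hw_pos] with x hx
  rw [ENNReal.toReal_ofReal hx.le, smul_eq_mul, mul_comm]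

/-- The mean value property, cleared of denominators and written with Lebesgue measure. -/
theorem IsStronglyHarmonic.mul_setIntegral_ball {n : ℕ} {N : Seminorm ℝ (Rn n)} {Ω : Set (Rn n)}
    {w u : Rn n → ℝ} (hw_int : LocallyIntegrableOn w Ω volume)
    (hw_pos : ∀ᵐ x ∂(volume.restrict Ω), 0 < w x)
    (hu : IsStronglyHarmonic N (weightedMeasure Ω w) Ω u) {x : Rn n} {r : ℝ} (hr : 0 < r)
    (hx : CompactlyContained (N.ball x r) Ω) :
    u x * ∫ y in N.ball x r, w y = ∫ y in N.ball x r, u y * w y := by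
  have hs := N.measurableSet_ball_Rn x r
  have hsΩ : N.ball x r ⊆ Ω := subset_closure.trans hx.2
  have hm : (weightedMeasure Ω w).real (N.ball x r) = ∫ y in N.ball x r, w y := by
    have := setIntegral_weightedMeasure hs hsΩ hw_int hw_pos (fun _ => 1)
    simpa using this
  have hpos : 0 < ∫ y in N.ball x r, w y :=
    setIntegral_pos_of_ae_pos (N.volume_ball_ne_zero x hr)
      (ae_restrict_of_ae_restrict_of_subset hsΩ hw_pos)
      ((hw_int.integrableOn_compact_subset hx.2 hx.1).mono_set subset_closure)
  rw [hu.2 x r hr hx, setAverage_eq, hm, setIntegral_weightedMeasure hs hsΩ hw_int hw_pos,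
    smul_eq_mul]
  field_simp

/-- The cone `y ↦ (R - N y)⁺`. It is the integral over the radii `r ∈ (0, R)` of the indicators
of the balls of radius `r`, and, unlike these, it is Lipschitz. -/
def coneKernel {n : ℕ} (N : Seminorm ℝ (Rn n)) (R : ℝ) (y : Rn n) : ℝ :=
  max 0 (R - N y)

theorem coneKernel_nonneg {n : ℕ} (N : Seminorm ℝ (Rn n)) (R : ℝ) (y : Rn n) :
    0 ≤ coneKernel N R y :=
  le_max_left _ _

theorem coneKernel_pos {n : ℕ} {N : Seminorm ℝ (Rn n)} {R : ℝ} {y : Rn n} (h : N y < R) :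
    0 < coneKernel N R y :=
  lt_max_of_lt_right (sub_pos.2 h)

theorem coneKernel_eq_zero {n : ℕ} {N : Seminorm ℝ (Rn n)} {R : ℝ} {y : Rn n} (h : R ≤ N y) :
    coneKernel N R y = 0 :=
  max_eq_left (sub_nonpos.2 h)

theorem abs_coneKernel_le {n : ℕ} (N : Seminorm ℝ (Rn n)) {R : ℝ} (hR : 0 ≤ R) (y : Rn n) :
    |coneKernel N R y| ≤ R := by
  rw [abs_of_nonneg (coneKernel_nonneg N R y)]
  exact max_le hR (sub_le_self _ (apply_nonneg N y))

theorem exists_lipschitzWith_coneKernel {n : ℕ} (N : Seminorm ℝ (Rn n)) (R : ℝ) :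
    ∃ C : NNReal, LipschitzWith C (coneKernel N R) := by
  obtain ⟨C, hC⟩ := N.exists_lipschitzWith
  have h : LipschitzWith C (fun y => R - N y) := by
    refine LipschitzWith.of_dist_le_mul fun x y => ?_
    rw [dist_sub_left]
    exact hC.dist_le_mul x y
  exact ⟨C, h.const_max 0⟩

/-- Fubini's theorem: the integral against the cone is the integral of the ball integrals over the
radii. -/
theorem integral_mul_coneKernel {n : ℕ} (N : Seminorm ℝ (Rn n)) {g : Rn n → ℝ} {x : Rn n} {R : ℝ}
    (hg : IntegrableOn g (N.ball x R) volume) :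
    ∫ y, g y * coneKernel N R (x - y) = ∫ r in Ioo 0 R, ∫ y in N.ball x r, g y := by
  have hb := N.measurableSet_ball_Rn x
  have hgi : Integrable ((N.ball x R).indicator g) := hg.integrable_indicator (hb R)
  have hcont : Continuous fun y => N (y - x) :=
    N.continuous_Rn.comp (continuous_id.sub continuous_const)
  have hA : MeasurableSet {p : ℝ × Rn n | N (p.2 - x) < p.1} :=
    (isOpen_lt (hcont.comp continuous_snd) continuous_fst).measurableSet
  have hint : Integrable ({p : ℝ × Rn n | N (p.2 - x) < p.1}.indicator
      fun p => (N.ball x R).indicator g p.2) ((volume.restrict (Ioo 0 R)).prod volume) :=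
    (hgi.comp_snd _).indicator hA
  have hswap := integral_integral_swap (f := fun (r : ℝ) (y : Rn n) =>
    {p : ℝ × Rn n | N (p.2 - x) < p.1}.indicator (fun p => (N.ball x R).indicator g p.2) (r, y))
    hint
  have h1 : ∀ r ∈ Ioo 0 R, ∫ y, {p : ℝ × Rn n | N (p.2 - x) < p.1}.indicator
      (fun p => (N.ball x R).indicator g p.2) (r, y) = ∫ y in N.ball x r, g y := by
    intro r hr
    rw [← integral_indicator (hb r)]
    congr 1
    funext y
    by_cases hy : N (y - x) < r
    · rw [indicator_of_mem (by exact hy), indicator_of_mem (by exact hy.trans hr.2),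
        indicator_of_mem (by exact hy)]
    · rw [indicator_of_notMem (by exact hy), indicator_of_notMem (by exact hy)]
  have h2 : ∀ y, ∫ r in Ioo 0 R, {p : ℝ × Rn n | N (p.2 - x) < p.1}.indicator
      (fun p => (N.ball x R).indicator g p.2) (r, y) = g y * coneKernel N R (x - y) := by
    intro y
    have e : ∀ r, {p : ℝ × Rn n | N (p.2 - x) < p.1}.indicator
        (fun p => (N.ball x R).indicator g p.2) (r, y) =
        (Ioi (N (y - x))).indicator (fun _ => (N.ball x R).indicator g y) r := fun r => rfl
    simp_rw [e]
    rw [setIntegral_indicator measurableSet_Ioi, setIntegral_const, smul_eq_mul]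
    have e2 : Ioo 0 R ∩ Ioi (N (y - x)) = Ioo (N (y - x)) R := by
      ext r
      simp only [mem_inter_iff, mem_Ioo, mem_Ioi]
      have := apply_nonneg N (y - x)
      constructor
      · exact fun h => ⟨h.2, h.1.2⟩
      · exact fun h => ⟨⟨by linarith, h.2⟩, h.1⟩
    rw [e2]
    by_cases hy : N (y - x) < R
    · rw [indicator_of_mem (by exact hy), Real.volume_real_Ioo_of_le hy.le, coneKernel,
        map_sub_rev N x y, max_eq_right (sub_nonneg.2 hy.le), mul_comm]
    · rw [indicator_of_notMem (by exact hy), coneKernel_eq_zero]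
      · simp
      · rw [map_sub_rev]
        exact not_lt.1 hy
  rw [setIntegral_congr_fun measurableSet_Ioo h1] at hswap
  rw [hswap]
  exact integral_congr_ae (Eventually.of_forall fun y => (h2 y).symm)

/-- The mean value property, averaged over the radii: it holds with the Lipschitz cone in place of
the indicator of a ball. -/
theorem IsStronglyHarmonic.mul_integral_coneKernel {n : ℕ} {N : Seminorm ℝ (Rn n)}
    {Ω T : Set (Rn n)} (hΩ : IsOpen Ω)
    {w u : Rn n → ℝ} (hw_int : LocallyIntegrableOn w Ω volume)
    (hw_pos : ∀ᵐ x ∂(volume.restrict Ω), 0 < w x)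
    (hu : IsStronglyHarmonic N (weightedMeasure Ω w) Ω u) (hT : IsCompact T) (hTΩ : T ⊆ Ω)
    {x : Rn n} {R : ℝ} (hx : N.ball x R ⊆ T) :
    u x * ∫ y, w y * coneKernel N R (x - y) = ∫ y, (u y * w y) * coneKernel N R (x - y) := by
  have huw := locallyIntegrableOn_mul_of_weightedMeasure hΩ hw_int hw_pos hu.1
  rw [integral_mul_coneKernel N ((hw_int.integrableOn_compact_subset hTΩ hT).mono_set hx),
    integral_mul_coneKernel N ((huw.integrableOn_compact_subset hTΩ hT).mono_set hx),
    ← integral_const_mul]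
  refine setIntegral_congr_fun measurableSet_Ioo fun r hr => ?_
  exact hu.mul_setIntegral_ball hw_int hw_pos hr.1
    (compactlyContained_ball hT hTΩ ((Seminorm.ball_mono hr.2.le).trans hx))

theorem integral_mul_coneKernel_pos {n : ℕ} (N : Seminorm ℝ (Rn n)) {Ω T : Set (Rn n)}
    {w : Rn n → ℝ} (hw_int : LocallyIntegrableOn w Ω volume)
    (hw_pos : ∀ᵐ x ∂(volume.restrict Ω), 0 < w x) (hT : IsCompact T) (hTΩ : T ⊆ Ω)
    {x : Rn n} {R : ℝ} (hR : 0 < R) (hx : N.ball x R ⊆ T) :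
    0 < ∫ y, w y * coneKernel N R (x - y) := by
  obtain ⟨C, hC⟩ := exists_lipschitzWith_coneKernel N R
  rw [← setIntegral_eq_integral_of_forall_compl_eq_zero (s := N.ball x R) fun y hy => by
    rw [coneKernel_eq_zero, mul_zero]
    rw [map_sub_rev]
    exact not_lt.1 hy]
  refine setIntegral_pos_of_ae_pos (N.volume_ball_ne_zero x hR) ?_ ?_
  · filter_upwards [ae_restrict_of_ae_restrict_of_subset (hx.trans hTΩ) hw_pos,
      ae_restrict_mem (N.measurableSet_ball_Rn x R)] with y hy hyb
    refine mul_pos hy (coneKernel_pos ?_)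
    rw [map_sub_rev]
    exact hyb
  · refine ((hw_int.integrableOn_compact_subset hTΩ hT).mono_set hx).mul_bdd (c := R) ?_
      (Eventually.of_forall fun y => abs_coneKernel_le N hR.le _)
    exact (hC.continuous.comp (continuous_const.sub continuous_id)).aestronglyMeasurable

/-! ### Regularity of strongly harmonic functions -/

/-- If `w` and `u w` have `k` weak derivatives, then `u`, being locally the quotient of their
convolutions with a cone, is of class `C^{k+1}`. -/
theorem IsStronglyHarmonic.contDiffOn_succ {n : ℕ} {N : Seminorm ℝ (Rn n)}
    (hN : ∀ x : Rn n, N x = 0 → x = 0) {Ω : Set (Rn n)} (hΩ : IsOpen Ω)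
    {w u : Rn n → ℝ} (hw_pos : ∀ᵐ x ∂(volume.restrict Ω), 0 < w x)
    (hu : IsStronglyHarmonic N (weightedMeasure Ω w) Ω u) {k : ℕ} (hw : MemSobolevOneLoc Ω k w)
    (huw : MemSobolevOneLoc Ω k fun x => u x * w x) : ContDiffOn ℝ (k + 1 : ℕ) u Ω := by
  intro x₀ hx₀
  obtain ⟨δ, hδ, hδΩ⟩ := nhds_basis_closedBall.mem_iff.1 (hΩ.mem_nhds hx₀)
  obtain ⟨R, hR, T, hT, hTΩ, hball⟩ :=
    N.exists_isCompact_ball_subset hN hΩ (isCompact_closedBall x₀ δ) hδΩ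
  obtain ⟨C, hC⟩ := exists_lipschitzWith_coneKernel N R
  have hbT : ∀ x ∈ ball x₀ δ, N.ball x R ⊆ T := fun x hx y hy =>
    hball x (ball_subset_closedBall hx) y (le_of_lt hy)
  have hKT : ∀ x ∈ ball x₀ δ, ∀ y, y ∉ T → coneKernel N R (x - y) = 0 := by
    intro x hx y hy
    refine coneKernel_eq_zero (not_lt.1 fun h => hy (hbT x hx ?_))
    rwa [map_sub_rev] at h
  have hF := huw.contDiffOn_integral_mul_comp_sub hΩ hC (abs_coneKernel_le N hR.le) isOpen_ball hT
    hTΩ hKT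
  have hG := hw.contDiffOn_integral_mul_comp_sub hΩ hC (abs_coneKernel_le N hR.le) isOpen_ball hT
    hTΩ hKT
  have hpos := fun x hx =>
    (integral_mul_coneKernel_pos N hw.locallyIntegrableOn hw_pos hT hTΩ hR (hbT x hx)).ne'
  have hquot : ContDiffOn ℝ (k + 1 : ℕ) u (ball x₀ δ) := by
    push_cast
    refine (hF.div hG hpos).congr fun x hx => ?_
    rw [Pi.div_apply, eq_div_iff (hpos x hx)]
    exact hu.mul_integral_coneKernel hΩ hw.locallyIntegrableOn hw_pos hT hTΩ (hbT x hx)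
  exact (hquot.contDiffAt (ball_mem_nhds x₀ hδ)).contDiffWithinAt

/-- Bootstrapping: every weak derivative of `w` gives one more classical derivative of `u`. -/
theorem IsStronglyHarmonic.contDiffOn_and_memSobolevOneLoc {n : ℕ} {N : Seminorm ℝ (Rn n)}
    (hN : ∀ x : Rn n, N x = 0 → x = 0) {Ω : Set (Rn n)} (hΩ : IsOpen Ω)
    {w u : Rn n → ℝ} (hw_pos : ∀ᵐ x ∂(volume.restrict Ω), 0 < w x)
    (hu : IsStronglyHarmonic N (weightedMeasure Ω w) Ω u) {k : ℕ} (hw : MemSobolevOneLoc Ω k w) :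
    ContDiffOn ℝ (k + 1 : ℕ) u Ω ∧ MemSobolevOneLoc Ω k fun x => u x * w x := by
  induction k with
  | zero =>
    have h := memSobolevOneLoc_zero
      (locallyIntegrableOn_mul_of_weightedMeasure hΩ hw.locallyIntegrableOn hw_pos hu.1)
    exact ⟨hu.contDiffOn_succ hN hΩ hw_pos hw h, h⟩
  | succ k ih =>
    have h := hw.mul hΩ (ih (hw.mono k.le_succ)).1
    exact ⟨hu.contDiffOn_succ hN hΩ hw_pos hw h, h⟩

end

/-! ### Expansion of ball averages in the radius -/

section
open Filter Topology Metric Set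
open scoped Pointwise

/-- Iterating `X^α ↦ ∑ᵢ X^{α + eᵢ}` produces the multinomial coefficients: this is
`(∑ᵢ Xᵢ)^j · ∑ᵢ Xᵢ = (∑ᵢ Xᵢ)^{j+1}`, to which the linear functional `X^β ↦ c β` is applied. -/
theorem sum_multinomial_mul_sum_add_single {n : ℕ} (c : (Fin n → ℕ) → ℝ) (j : ℕ) :
    ∑ α ∈ Finset.piAntidiag Finset.univ j,
        (Nat.multinomial Finset.univ α : ℝ) * ∑ i, c (α + Pi.single i 1) =
      ∑ β ∈ Finset.piAntidiag Finset.univ (j + 1),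
        (Nat.multinomial Finset.univ β : ℝ) * c β := by
  let L : MvPolynomial (Fin n) ℝ →ₗ[ℝ] ℝ :=
    (MvPolynomial.basisMonomials (Fin n) ℝ).constr ℝ fun m => c m
  have hL : ∀ α : Fin n → ℕ, L (∏ i, MvPolynomial.X i ^ α i) = c α := by
    intro α
    have h1 : (∏ i, MvPolynomial.X i ^ α i : MvPolynomial (Fin n) ℝ) =
        MvPolynomial.basisMonomials (Fin n) ℝ (Finsupp.equivFunOnFinite.symm α) := by
      rw [MvPolynomial.coe_basisMonomials]
      simp only
      rw [MvPolynomial.monomial_eq, Finsupp.prod_fintype _ _ (by simp)]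
      simp
    rw [h1, Module.Basis.constr_basis]
    simp
  have hL' : ∀ (m : ℕ) (p : MvPolynomial (Fin n) ℝ), L ((m : MvPolynomial (Fin n) ℝ) * p) =
      (m : ℝ) * L p := by
    intro m p
    rw [← nsmul_eq_mul, map_nsmul, nsmul_eq_mul]
  have e := congrArg L (pow_succ (∑ i, (MvPolynomial.X i : MvPolynomial (Fin n) ℝ)) j)
  rw [Finset.sum_pow_eq_sum_piAntidiag, Finset.sum_pow_eq_sum_piAntidiag, Finset.sum_mul,
    map_sum, map_sum] at e
  simp_rw [hL', hL] at e
  rw [e]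
  refine Finset.sum_congr rfl fun α _ => ?_
  rw [mul_assoc, hL', Finset.mul_sum Finset.univ _ (∏ i, _), map_sum]
  congr 1
  refine Finset.sum_congr rfl fun i _ => ?_
  rw [← hL]
  congr 1
  simp_rw [Pi.add_apply, pow_add, Finset.prod_mul_distrib]
  congr 1
  rw [Finset.prod_eq_single i (fun k _ hk => by simp [Pi.single_eq_of_ne hk]) (by simp)]
  simp

/-- If each `c α` has derivative `∑ᵢ c (α + eᵢ)`, as the functions `r ↦ y^α D^α f(x + r y)` have,
and `c 0` vanishes near `0`, then so do all the multinomial sums `∑_{|α| = j} (|α|!/α!) c α`. -/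
theorem sum_multinomial_mul_eq_zero {n m : ℕ} {R : ℝ} {c : (Fin n → ℕ) → ℝ → ℝ}
    (hc : ∀ α : Fin n → ℕ, ∑ i, α i < m → ∀ r ∈ Ioo (-R) R,
      HasDerivAt (c α) (∑ i, c (α + Pi.single i 1) r) r)
    (h0 : ∀ r ∈ Ioo (-R) R, c 0 r = 0) :
    ∀ j ≤ m, ∀ r ∈ Ioo (-R) R, ∑ α ∈ Finset.piAntidiag Finset.univ j,
      (Nat.multinomial Finset.univ α : ℝ) * c α r = 0 := by
  intro j
  induction j with
  | zero =>
    intro _ r hr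
    simp [h0 r hr]
  | succ j ih =>
    intro hj r hr
    have h1 : HasDerivAt (fun r => ∑ α ∈ Finset.piAntidiag Finset.univ j,
        (Nat.multinomial Finset.univ α : ℝ) * c α r)
        (∑ α ∈ Finset.piAntidiag Finset.univ j,
          (Nat.multinomial Finset.univ α : ℝ) * ∑ i, c (α + Pi.single i 1) r) r := by
      refine HasDerivAt.fun_sum fun α hα => (hc α ?_ r hr).const_mul _
      rw [(Finset.mem_piAntidiag.1 hα).1]
      omega
    have h2 : HasDerivAt (fun r => ∑ α ∈ Finset.piAntidiag Finset.univ j,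
        (Nat.multinomial Finset.univ α : ℝ) * c α r) 0 r := by
      refine (hasDerivAt_const r (0 : ℝ)).congr_of_eventuallyEq ?_
      filter_upwards [isOpen_Ioo.mem_nhds hr] with s hs using ih (by omega) s hs
    rw [← sum_multinomial_mul_sum_add_single (fun α => c α r)]
    exact h1.unique h2

/-- `∫∫ g(z) p(y) ψ(z - r y) dz dν(y)`. With `ν` the Lebesgue measure on the unit ball and `p = 1`,
this is up to scaling the integral of `ψ` against the averages of `g` over balls of radius `|r|`. -/
noncomputable def dilationPairing {n : ℕ} (ν : Measure (Rn n)) (g p ψ : Rn n → ℝ) (r : ℝ) : ℝ :=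
  ∫ q : Rn n × Rn n, g q.1 * p q.2 * ψ (q.1 - r • q.2) ∂(volume.prod ν)

theorem integrable_dilationPairing {n : ℕ} {ν : Measure (Rn n)} [SFinite ν] {g p ψ : Rn n → ℝ}
    (hg : Integrable g) (hp : Integrable p ν) (hψ : Continuous ψ) {M : ℝ} (hM : ∀ x, |ψ x| ≤ M)
    (r : ℝ) : Integrable (fun q : Rn n × Rn n => g q.1 * p q.2 * ψ (q.1 - r • q.2))
      (volume.prod ν) :=
  (hg.mul_prod hp).mul_bdd (c := M)
    (hψ.comp (continuous_fst.sub (continuous_snd.const_smul r))).aestronglyMeasurable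
    (Eventually.of_forall fun _ => hM _)

theorem hasDerivAt_dilationPairing {n : ℕ} {ν : Measure (Rn n)} [SFinite ν] {g p ψ : Rn n → ℝ}
    (hg : Integrable g) (hp : Integrable p ν) (hpi : ∀ i, Integrable (fun y => p y * y i) ν)
    (hψ : ContDiff ℝ 1 ψ) (hc : HasCompactSupport ψ) (r : ℝ) :
    HasDerivAt (dilationPairing ν g p ψ)
      (- ∑ i, dilationPairing ν g (fun y => p y * y i) (partialD i ψ) r) r := by
  obtain ⟨C, hC⟩ := hψ.lipschitzWith_of_hasCompactSupport hc one_ne_zero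
  obtain ⟨M, hM⟩ := hc.exists_bound_of_continuous hψ.continuous
  have hpc : ∀ i, Continuous (partialD i ψ) := fun i =>
    (hψ.continuous_fderiv one_ne_zero).clm_apply continuous_const
  have hI : ∀ i s, Integrable (fun q : Rn n × Rn n =>
      g q.1 * (p q.2 * q.2 i) * partialD i ψ (q.1 - s • q.2)) (volume.prod ν) := fun i s =>
    integrable_dilationPairing hg (hpi i) (hpc i) (abs_partialD_le hC i) s
  have key := hasDerivAt_integral_of_dominated_loc_of_deriv_le (μ := volume.prod ν) (x₀ := r)
    (s := univ) (F := fun s (q : Rn n × Rn n) => g q.1 * p q.2 * ψ (q.1 - s • q.2))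
    (F' := fun s q => ∑ i, -(g q.1 * (p q.2 * q.2 i) * partialD i ψ (q.1 - s • q.2)))
    (bound := fun q => ∑ i, ‖g q.1 * (p q.2 * q.2 i)‖ * C) univ_mem
    (Eventually.of_forall fun s => (integrable_dilationPairing hg hp hψ.continuous hM s).1)
    (integrable_dilationPairing hg hp hψ.continuous hM r)
    (integrable_finsetSum _ fun i _ => (hI i r).neg).1
    (Eventually.of_forall fun q s _ => ?_)
    (integrable_finsetSum _ fun i _ => (hg.mul_prod (hpi i)).norm.mul_const _)
    (Eventually.of_forall fun q s _ => ?_)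
  · have h := key.2
    rw [integral_finsetSum (f := fun i (q : Rn n × Rn n) =>
      -(g q.1 * (p q.2 * q.2 i) * partialD i ψ (q.1 - r • q.2))) _ fun i _ => (hI i r).neg] at h
    simp_rw [integral_neg] at h
    rw [Finset.sum_neg_distrib] at h
    exact h
  · refine (norm_sum_le _ _).trans (Finset.sum_le_sum fun i _ => ?_)
    rw [norm_neg, norm_mul]
    exact mul_le_mul_of_nonneg_left (abs_partialD_le hC i _) (norm_nonneg _)
  · have h1 : HasDerivAt (fun s : ℝ => q.1 - s • q.2) (-q.2) s := by
      simpa using ((hasDerivAt_id s).smul_const q.2).const_sub q.1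
    have h2 := ((hψ.differentiable one_ne_zero (q.1 - s • q.2)).hasFDerivAt.comp_hasDerivAt s
      h1).const_mul (g q.1 * p q.2)
    refine h2.congr_deriv ?_
    symm
    rw [map_neg, mul_neg, Finset.sum_neg_distrib]
    congr 1
    rw [clm_apply_eq_sum_single _ q.2, Finset.mul_sum]
    refine Finset.sum_congr rfl fun i _ => ?_
    rw [partialD]
    ring

/-- Integration by parts in `dilationPairing`, for a weakly differentiable function cut off to a
compact set `T` that contains the supports of all the translated functions `ψ(· - r y)`. -/
theorem HasWeakPartial.dilationPairing_partialD {n : ℕ} {ν : Measure (Rn n)} [SFinite ν]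
    {Ω T : Set (Rn n)} (hΩ : IsOpen Ω) (hT : IsCompact T) (hTΩ : T ⊆ Ω) {i : Fin n}
    {f g p ψ : Rn n → ℝ} (h : HasWeakPartial Ω i f g) (hp : Integrable p ν)
    (hψ : ContDiff ℝ 1 ψ) (hc : HasCompactSupport ψ) {r : ℝ}
    (hr : ∀ᵐ y ∂ν, ∀ z, z - r • y ∈ tsupport ψ → z ∈ T) :
    dilationPairing ν (T.indicator f) p (partialD i ψ) r =
      - dilationPairing ν (T.indicator g) p ψ r := by
  obtain ⟨C, hC⟩ := hψ.lipschitzWith_of_hasCompactSupport hc one_ne_zero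
  obtain ⟨M, hM⟩ := hc.exists_bound_of_continuous hψ.continuous
  have hpc : Continuous (partialD i ψ) :=
    (hψ.continuous_fderiv one_ne_zero).clm_apply continuous_const
  have hfT : Integrable (T.indicator f) :=
    (h.1.integrableOn_compact_subset hTΩ hT).integrable_indicator hT.measurableSet
  have hgT : Integrable (T.indicator g) :=
    (h.2.1.integrableOn_compact_subset hTΩ hT).integrable_indicator hT.measurableSet
  unfold dilationPairing
  rw [integral_prod_symm _ (integrable_dilationPairing hfT hp hpc (abs_partialD_le hC i) r),
    integral_prod_symm _ (integrable_dilationPairing hgT hp hψ.continuous hM r), ← integral_neg]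
  refine integral_congr_ae ?_
  filter_upwards [hr] with y hy
  have hcont : Continuous fun z : Rn n => z - r • y := continuous_id.sub continuous_const
  have hsT : tsupport (fun z => ψ (z - r • y)) ⊆ T :=
    closure_minimal (fun z hz => hy z (subset_tsupport _ hz)) hT.isClosed
  have hL : LipschitzWith C (fun z => ψ (z - r • y)) := by
    refine LipschitzWith.of_dist_le_mul fun a b => ?_
    simpa only [dist_sub_right] using hC.dist_le_mul (a - r • y) (b - r • y)
  have key := h.integral_mul_partialD hΩ hL (hT.of_isClosed_subset (isClosed_tsupport _) hsT)
    (hsT.trans hTΩ)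
  have hpart : ∀ z, partialD i (fun z => ψ (z - r • y)) z = partialD i ψ (z - r • y) := by
    intro z
    unfold partialD
    rw [fderiv_comp_sub]
  have hz0 : ∀ z, z ∉ T → ψ (z - r • y) = 0 := fun z hz =>
    image_eq_zero_of_notMem_tsupport fun h' => hz (hy z h')
  have hz1 : ∀ z, z ∉ T → partialD i ψ (z - r • y) = 0 := fun z hz =>
    image_eq_zero_of_notMem_tsupport fun h' => hz (hy z (tsupport_partialD_subset _ i h'))
  simp_rw [hpart] at key
  rw [setIntegral_eq_integral_of_forall_compl_eq_zero
      (fun z hz => by rw [hz1 z fun h' => hz (hTΩ h'), mul_zero]),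
    setIntegral_eq_integral_of_forall_compl_eq_zero
      (fun z hz => by rw [hz0 z fun h' => hz (hTΩ h'), mul_zero])] at key
  have e1 : (fun z => T.indicator f z * p y * partialD i ψ (z - r • y)) =
      fun z => p y * (f z * partialD i ψ (z - r • y)) := by
    funext z
    by_cases hz : z ∈ T
    · rw [indicator_of_mem hz]; ring
    · rw [hz1 z hz]; ring
  have e2 : (fun z => T.indicator g z * p y * ψ (z - r • y)) =
      fun z => p y * (g z * ψ (z - r • y)) := by
    funext z
    by_cases hz : z ∈ T
    · rw [indicator_of_mem hz]; ring
    · rw [hz0 z hz]; ring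
  simp only [e1, e2]
  rw [integral_const_mul, integral_const_mul, key]
  ring

/-- At `r = 0` the pairing is a product of two integrals. -/
theorem dilationPairing_zero {n : ℕ} {ν : Measure (Rn n)} [SFinite ν] (g p ψ : Rn n → ℝ) :
    dilationPairing ν g p ψ 0 = (∫ z, g z * ψ z) * ∫ y, p y ∂ν := by
  unfold dilationPairing
  rw [← integral_prod_mul (μ := volume) (ν := ν) (fun z => g z * ψ z) p]
  congr 1
  funext q
  rw [zero_smul, sub_zero]
  ring

/-- The pairing with the unit ball, as an integral of `ψ` against ball integrals of `g`. -/
theorem dilationPairing_ball {n : ℕ} (N : Seminorm ℝ (Rn n)) (hB : volume (N.ball 0 1) ≠ ⊤)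
    {g ψ : Rn n → ℝ} (hg : Integrable g) (hψ : Continuous ψ) (hc : HasCompactSupport ψ) {r : ℝ}
    (hr : r ≠ 0) :
    dilationPairing (volume.restrict (N.ball 0 1)) g (fun _ => 1) ψ r =
      |(r ^ n)⁻¹| * ∫ x, ψ x * ∫ z in N.ball x |r|, g z := by
  obtain ⟨M, hM⟩ := hc.exists_bound_of_continuous hψ
  have hb := N.measurableSet_ball_Rn
  have hsmul : r • N.ball 0 1 = N.ball 0 |r| := by
    rw [Seminorm.smul_ball_zero hr, mul_one, Real.norm_eq_abs]
  have hBr : volume (N.ball 0 |r|) ≠ ⊤ := by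
    rw [← hsmul, Measure.addHaar_smul]
    exact ENNReal.mul_ne_top ENNReal.ofReal_ne_top hB
  have hint : ∀ s : ℝ, ∀ S : Set (Rn n), volume S ≠ ⊤ →
      Integrable (fun q : Rn n × Rn n => g q.1 * (fun _ => (1 : ℝ)) q.2 * ψ (q.1 - s • q.2))
        (volume.prod (volume.restrict S)) := fun s S hS =>
    integrable_dilationPairing hg (integrableOn_const hS) hψ hM s
  have e1 : dilationPairing (volume.restrict (N.ball 0 1)) g (fun _ => 1) ψ r =
      |(r ^ n)⁻¹| * ∫ y in N.ball 0 |r|, ∫ z, g z * ψ (z - y) := by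
    unfold dilationPairing
    rw [integral_prod_symm _ (hint r _ hB)]
    have := Measure.setIntegral_comp_smul volume (fun y : Rn n => ∫ z, g z * ψ (z - y))
      (R := r) (N.ball 0 1) hr
    rw [hsmul, finrank_euclideanSpace_fin, smul_eq_mul] at this
    simp only [mul_one]
    exact this
  -- Exchange the order of integration, and substitute `y = z - x`.
  have hswap : ∫ y in N.ball 0 |r|, ∫ z, g z * ψ (z - y) =
      ∫ z, ∫ y in N.ball 0 |r|, g z * ψ (z - y) := by
    have h1 := hint 1 _ hBr
    simp only [mul_one, one_smul] at h1
    exact (integral_integral_swap h1).symm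
  have hsub : ∀ z, ∫ y in N.ball 0 |r|, g z * ψ (z - y) =
      ∫ x, (N.ball x |r|).indicator (fun z => ψ x * g z) z := by
    intro z
    rw [← integral_indicator (hb 0 |r|), ← integral_sub_left_eq_self _ volume z]
    congr 1
    funext x
    by_cases hx : N (z - x) < |r|
    · rw [indicator_of_mem (by rw [N.mem_ball_zero]; exact hx), indicator_of_mem (by exact hx),
        sub_sub_cancel, mul_comm]
    · rw [indicator_of_notMem (by rw [N.mem_ball_zero]; exact hx),
        indicator_of_notMem (by exact hx)]
  have hA : MeasurableSet {p : Rn n × Rn n | N (p.1 - p.2) < |r|} :=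
    (isOpen_lt (N.continuous_Rn.comp (continuous_fst.sub continuous_snd))
      continuous_const).measurableSet
  have hint2 : Integrable (fun p : Rn n × Rn n =>
      (N.ball p.2 |r|).indicator (fun z => ψ p.2 * g z) p.1) (volume.prod volume) := by
    have h2 := (hg.mul_prod
      (hψ.integrable_of_hasCompactSupport (μ := volume) hc)).indicator hA
    refine h2.congr (Eventually.of_forall fun p => ?_)
    simp only
    by_cases hp : N (p.1 - p.2) < |r|
    · rw [indicator_of_mem (by exact hp), indicator_of_mem (by exact hp), mul_comm]
    · rw [indicator_of_notMem (by exact hp), indicator_of_notMem (by exact hp)]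
  rw [e1, hswap]
  simp_rw [hsub]
  rw [integral_integral_swap hint2]
  congr 2
  funext x
  rw [integral_indicator (hb x |r|), integral_const_mul]

end

/-! ### The weak equations -/

section
open Filter Topology Metric Set

/-- A coherent choice of all weak derivatives of order at most `k`. -/
theorem MemSobolevOneLoc.exists_family {n : ℕ} {Ω : Set (Rn n)} {k : ℕ} {f : Rn n → ℝ}
    (hf : MemSobolevOneLoc Ω k f) : ∃ P : (Fin n → ℕ) → Rn n → ℝ, P 0 = f ∧
      (∀ α, ∑ i, α i ≤ k → HasWeakD Ω α f (P α)) ∧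
      ∀ α i, ∑ i, α i < k → HasWeakPartial Ω i (P α) (P (α + Pi.single i 1)) := by
  choose! P hP using hf
  have hP' : ∀ α, ∑ i, α i ≤ k → HasWeakD Ω α f (Function.update P 0 f α) := by
    intro α hα
    by_cases h : α = 0
    · subst h
      rw [Function.update_self]
      exact hasWeakD_zero (hP 0 hα).1
    · rw [Function.update_of_ne h]
      exact hP α hα
  refine ⟨Function.update P 0 f, Function.update_self .., hP', fun α i hα => ?_⟩
  exact (hP' α hα.le).hasWeakPartial (hP' _ (by rw [sum_add_single]; omega))

theorem prod_pow_add_single {n : ℕ} (α : Fin n → ℕ) (i : Fin n) (y : Rn n) :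
    ∏ k, y k ^ (α + Pi.single i 1 : Fin n → ℕ) k = (∏ k, y k ^ α k) * y i := by
  simp_rw [Pi.add_apply, pow_add, Finset.prod_mul_distrib]
  congr 1
  rw [Finset.prod_eq_single i (fun k _ hk => by simp [Pi.single_eq_of_ne hk]) (by simp)]
  simp

theorem Seminorm.exists_ball_subset_closedBall {n : ℕ} (N : Seminorm ℝ (Rn n))
    (hN : ∀ x : Rn n, N x = 0 → x = 0) : ∃ M : ℝ, N.ball 0 1 ⊆ Metric.closedBall (0 : Rn n) M := by
  obtain ⟨c, hc, hcN⟩ := N.exists_mul_norm_le hN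
  refine ⟨c⁻¹, fun y hy => ?_⟩
  rw [N.mem_ball_zero] at hy
  rw [mem_closedBall_zero_iff, ← one_div, le_div_iff₀' hc]
  exact (hcN y).trans hy.le

theorem Seminorm.integrableOn_ball_prod_pow {n : ℕ} (N : Seminorm ℝ (Rn n))
    (hN : ∀ x : Rn n, N x = 0 → x = 0) (α : Fin n → ℕ) :
    IntegrableOn (fun y : Rn n => ∏ i, y i ^ α i) (N.ball 0 1) volume := by
  obtain ⟨M, hM⟩ := N.exists_ball_subset_closedBall hN
  have h : Continuous fun y : Rn n => ∏ i, y i ^ α i := by fun_prop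
  exact (h.continuousOn.integrableOn_compact (isCompact_closedBall 0 M)).mono_set hM

/-- Differentiating a ball average in the radius: each derivative falls on `P α` and brings down a
factor `y i`. -/
theorem hasDerivAt_dilationPairing_prod_pow {n : ℕ} {N : Seminorm ℝ (Rn n)}
    (hN : ∀ x : Rn n, N x = 0 → x = 0) {Ω T : Set (Rn n)} (hΩ : IsOpen Ω) (hT : IsCompact T)
    (hTΩ : T ⊆ Ω) {P : (Fin n → ℕ) → Rn n → ℝ} {α : Fin n → ℕ}
    (hP : ∀ i, HasWeakPartial Ω i (P α) (P (α + Pi.single i 1)))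
    (hα : LocallyIntegrableOn (P α) Ω volume)
    {ψ : Rn n → ℝ} (hψ : ContDiff ℝ 1 ψ) (hc : HasCompactSupport ψ) {R r : ℝ} (hr : |r| ≤ R)
    (hball : ∀ x ∈ tsupport ψ, ∀ y, N (y - x) ≤ R → y ∈ T) :
    HasDerivAt (dilationPairing (volume.restrict (N.ball 0 1)) (T.indicator (P α))
        (fun y => ∏ k, y k ^ α k) ψ)
      (∑ i, dilationPairing (volume.restrict (N.ball 0 1)) (T.indicator (P (α + Pi.single i 1)))
        (fun y => ∏ k, y k ^ (α + Pi.single i 1 : Fin n → ℕ) k) ψ r) r := by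
  have hαT : Integrable (T.indicator (P α)) :=
    (hα.integrableOn_compact_subset hTΩ hT).integrable_indicator hT.measurableSet
  have hpi : ∀ i, Integrable (fun y : Rn n => (∏ k, y k ^ α k) * y i)
      (volume.restrict (N.ball 0 1)) := by
    intro i
    simp_rw [← prod_pow_add_single]
    exact N.integrableOn_ball_prod_pow hN _
  have hmem : ∀ᵐ y ∂(volume.restrict (N.ball 0 1)), ∀ z, z - r • y ∈ tsupport ψ → z ∈ T := by
    filter_upwards [ae_restrict_mem (N.measurableSet_ball_Rn 0 1)] with y hy z hz
    refine hball _ hz z ?_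
    rw [N.mem_ball_zero] at hy
    rw [sub_sub_cancel, map_smul_eq_mul, Real.norm_eq_abs]
    calc |r| * N y ≤ |r| * 1 := by gcongr
      _ ≤ R := by rwa [mul_one]
  refine (hasDerivAt_dilationPairing hαT (N.integrableOn_ball_prod_pow hN α) hpi hψ hc
    r).congr_deriv ?_
  rw [← Finset.sum_neg_distrib]
  refine Finset.sum_congr rfl fun i _ => ?_
  rw [(hP i).dilationPairing_partialD hΩ hT hTΩ (hpi i) hψ hc hmem, neg_neg]
  simp_rw [prod_pow_add_single]

/-- The mean value property in weak form: ball averages of `u w`, tested with `φ`, agree with ball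
averages of `w`, tested with `u φ`. -/
theorem IsStronglyHarmonic.dilationPairing_eq {n : ℕ} {N : Seminorm ℝ (Rn n)}
    (hN : ∀ x : Rn n, N x = 0 → x = 0) {Ω T : Set (Rn n)} (hΩ : IsOpen Ω) {w u : Rn n → ℝ}
    (hw_int : LocallyIntegrableOn w Ω volume) (hw_pos : ∀ᵐ x ∂(volume.restrict Ω), 0 < w x)
    (hu : IsStronglyHarmonic N (weightedMeasure Ω w) Ω u) (hT : IsCompact T) (hTΩ : T ⊆ Ω)
    {φ : Rn n → ℝ} (hφ : Continuous φ) (hφc : HasCompactSupport φ)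
    (huφ : Continuous fun x => u x * φ x) {R r : ℝ} (hr : |r| ≤ R)
    (hball : ∀ x ∈ tsupport φ, ∀ y, N (y - x) ≤ R → y ∈ T) :
    dilationPairing (volume.restrict (N.ball 0 1)) (T.indicator fun x => u x * w x)
        (fun _ => 1) φ r =
      dilationPairing (volume.restrict (N.ball 0 1)) (T.indicator w)
        (fun _ => 1) (fun x => u x * φ x) r := by
  have huw := locallyIntegrableOn_mul_of_weightedMeasure hΩ hw_int hw_pos hu.1
  obtain rfl | hr0 := eq_or_ne r 0
  · rw [dilationPairing_zero, dilationPairing_zero]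
    congr 2
    funext z
    by_cases hz : z ∈ T
    · rw [indicator_of_mem hz, indicator_of_mem hz]; ring
    · rw [indicator_of_notMem hz, indicator_of_notMem hz]; ring
  · obtain ⟨M, hM⟩ := N.exists_ball_subset_closedBall hN
    have hB : volume (N.ball 0 1) ≠ ⊤ :=
      measure_ne_top_of_subset hM (isCompact_closedBall 0 M).measure_lt_top.ne
    have huφc : HasCompactSupport fun x => u x * φ x :=
      hφc.of_isClosed_subset (isClosed_tsupport _) tsupport_mul_subset_right
    rw [dilationPairing_ball N hB ((huw.integrableOn_compact_subset hTΩ hT).integrable_indicator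
        hT.measurableSet) hφ hφc hr0,
      dilationPairing_ball N hB ((hw_int.integrableOn_compact_subset hTΩ hT).integrable_indicator
        hT.measurableSet) huφ huφc hr0]
    congr 2
    funext x
    by_cases hx : x ∈ tsupport φ
    · have hxT : N.ball x |r| ⊆ T := fun y hy => hball x hx y (le_trans (le_of_lt hy) hr)
      have e : ∀ g : Rn n → ℝ, ∫ z in N.ball x |r|, T.indicator g z = ∫ z in N.ball x |r|, g z :=
        fun g => setIntegral_congr_fun (N.measurableSet_ball_Rn x _)
          fun z hz => indicator_of_mem (hxT hz) g
      rw [e, e, ← hu.mul_setIntegral_ball hw_int hw_pos (abs_pos.2 hr0)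
        (compactlyContained_ball hT hTΩ hxT)]
      ring
    · rw [image_eq_zero_of_notMem_tsupport hx]
      ring

end

theorem theorem1p2 {n : ℕ} (N : Seminorm ℝ (Rn n)) (hN : ∀ x : Rn n, N x = 0 → x = 0)
    (Ω : Set (Rn n)) (hΩ : IsOpen Ω) (w : Rn n → ℝ)
    (hw_int : LocallyIntegrableOn w Ω volume)
    (hw_pos : ∀ᵐ x ∂(volume.restrict Ω), 0 < w x)
    (l : ℕ) (hl : 1 ≤ l) (hw : MemSobolevInftyLoc Ω (2 * l) w)
    (u : Rn n → ℝ) (hu : IsStronglyHarmonic N (weightedMeasure Ω w) Ω u) :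
    ∀ j : ℕ, Even j → 2 ≤ j → j ≤ 2 * l → IsWeakSolution N Ω w u j := by
  intro j _ _ hjl
  have hwW := hw.memSobolevOneLoc
  obtain ⟨huC, huwW⟩ := hu.contDiffOn_and_memSobolevOneLoc hN hΩ hw_pos hwW
  obtain ⟨P, hP0, hPD, hPp⟩ := huwW.exists_family
  obtain ⟨Q, hQ0, hQD, hQp⟩ := hwW.exists_family
  have hle : ∀ α ∈ Finset.piAntidiag (Finset.univ : Finset (Fin n)) j, ∑ i, α i ≤ 2 * l :=
    fun α hα => (Finset.mem_piAntidiag.1 hα).1.trans_le hjl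
  have huQ : ∀ α, ∑ i, α i ≤ 2 * l → LocallyIntegrableOn (fun x => u x * Q α x) Ω volume :=
    fun α hα => (hQD α hα).2.1.continuousOn_mul huC.continuousOn hΩ.isLocallyClosed
  refine ⟨P, Q, fun α hα => ⟨hPD α (hle α hα), hQD α (hle α hα), huQ α (hle α hα)⟩,
    fun φ hφ => ?_⟩
  have hφ1 : ContDiff ℝ 1 φ := contDiff_infty.1 hφ.1 1
  have hψ : ContDiff ℝ 1 fun x => u x * φ x :=
    contDiff_mul_of_tsupport_subset hΩ (huC.of_le (by norm_cast; omega)) hφ1 hφ.2.2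
  have hψs : tsupport (fun x => u x * φ x) ⊆ tsupport φ := tsupport_mul_subset_right
  have hψc : HasCompactSupport fun x => u x * φ x :=
    hφ.2.1.of_isClosed_subset (isClosed_tsupport _) hψs
  obtain ⟨R, hR, T, hT, hTΩ, hball⟩ :=
    N.exists_isCompact_ball_subset hN hΩ hφ.2.1.isCompact hφ.2.2
  have hST : tsupport φ ⊆ T := fun x hx => hball x hx x (by simpa using hR.le)
  have hvanish := sum_multinomial_mul_eq_zero (m := 2 * l) (R := R)
    (c := fun α r =>
      dilationPairing (volume.restrict (N.ball 0 1)) (T.indicator (P α))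
          (fun y => ∏ k, y k ^ α k) φ r -
        dilationPairing (volume.restrict (N.ball 0 1)) (T.indicator (Q α))
          (fun y => ∏ k, y k ^ α k) (fun x => u x * φ x) r)
    (fun α hα r hr => by
      have hr' : |r| ≤ R := abs_le.2 ⟨hr.1.le, hr.2.le⟩
      rw [Finset.sum_sub_distrib]
      exact (hasDerivAt_dilationPairing_prod_pow hN hΩ hT hTΩ (fun i => hPp α i hα)
          (hPD α hα.le).2.1 hφ1 hφ.2.1 hr' hball).sub
        (hasDerivAt_dilationPairing_prod_pow hN hΩ hT hTΩ (fun i => hQp α i hα)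
          (hQD α hα.le).2.1 hψ hψc hr' fun x hx => hball x (hψs hx)))
    (fun r hr => by
      have hr' : |r| ≤ R := abs_le.2 ⟨hr.1.le, hr.2.le⟩
      simp only [hP0, hQ0, Pi.zero_apply, pow_zero, Finset.prod_const_one]
      rw [hu.dilationPairing_eq hN hΩ hw_int hw_pos hT hTΩ hφ1.continuous hφ.2.1 hψ.continuous
        hr' hball, sub_self])
    j hjl 0 ⟨neg_lt_zero.2 hR, hR⟩
  -- Cut-offs to `T` do not affect integrals against functions supported in `tsupport φ`.
  have hcut : ∀ (g ψ : Rn n → ℝ), tsupport ψ ⊆ tsupport φ →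
      ∫ z, T.indicator g z * ψ z = ∫ z in Ω, g z * ψ z := by
    intro g ψ hs
    rw [setIntegral_eq_integral_of_forall_compl_eq_zero fun z hz => by
      rw [image_eq_zero_of_notMem_tsupport fun h => hz (hφ.2.2 (hs h)), mul_zero]]
    congr 1
    funext z
    by_cases hz : z ∈ tsupport ψ
    · rw [Set.indicator_of_mem (hST (hs hz))]
    · rw [image_eq_zero_of_notMem_tsupport hz, mul_zero, mul_zero]
  simp only [dilationPairing_zero] at hvanish
  rw [← hvanish]
  have hi1 : ∀ α, ∑ i, α i ≤ 2 * l → IntegrableOn (fun x => P α x * φ x) Ω volume := fun α hα =>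
    (hPD α hα).2.1.integrableOn_mul hφ1.continuous hφ.2.1 hφ.2.2
  have hi2 : ∀ α, ∑ i, α i ≤ 2 * l → IntegrableOn (fun x => Q α x * (u x * φ x)) Ω volume :=
    fun α hα => (hQD α hα).2.1.integrableOn_mul hψ.continuous hψc (hψs.trans hφ.2.2)
  have e : ∀ x, φ x * ∑ α ∈ Finset.piAntidiag Finset.univ j,
      coeffA N α * (P α x - u x * Q α x) = ∑ α ∈ Finset.piAntidiag Finset.univ j,
        coeffA N α * (P α x * φ x - Q α x * (u x * φ x)) := by
    intro x
    rw [Finset.mul_sum]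
    exact Finset.sum_congr rfl fun α _ => by ring
  simp_rw [e]
  rw [integral_finsetSum (f := fun α x => coeffA N α * (P α x * φ x - Q α x * (u x * φ x))) _
    fun α hα => ((hi1 α (hle α hα)).sub (hi2 α (hle α hα))).const_mul _]
  refine Finset.sum_congr rfl fun α hα => ?_
  rw [integral_const_mul, integral_sub (hi1 α (hle α hα)) (hi2 α (hle α hα)),
    hcut _ _ subset_rfl, hcut _ _ hψs, coeffA]
  ring
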